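/- Let $T$ be a complete first-order theory and $\bar M$ a monster model of $T$: for some cardinal $\kappa>|T|+\aleph_0$, $\bar M$ is $\kappa$-saturated and strongly $\kappa$-homogeneous; subsets of $\bar M$ of cardinality $<\kappa$ are called small. A global type is a complete type over $\bar M$ in a finite tuple of variables; $\mathfrak p_{\upharpoonright B}$ is the set of formulas of $\mathfrak p$ with parameters in $B$. $\mathfrak p$ is $A$-invariant if for all finite tuples $\bar b_1\equiv\bar b_2\,(A)$ and all formulas $\phi(\bar x;\bar y)$ over $A$, $(\phi(\bar x,\bar b_1)\Leftrightarrow\phi(\bar x,\bar b_2))\in\mathfrak p$. A sequence $(\bar a_i\mid i<\alpha)$ is a Morley sequence in $\mathfrak p$ over $A$ if $\bar a_i\models\mathfrak p_{\upharpoonright A\bar a_{<i}}$ for all $i<\alpha$. If $\mathfrak p$ is invariant over some small set, then $\mathfrak p^{\omega}$ is the type over $\bar M$, in the variables $(\bar x_i\mid i<\omega)$, whose restriction to any small $C$ over which $\mathfrak p$ is invariant is the type over $C$ of a Morley sequence of length $\omega$ in $\mathfrak p$ over $C$. A global type $\mathfrak p$ is non-algebraic if no formula in $\mathfrak p$ has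 only finitely many solutions. A non-algebraic $\mathfrak p$ is generically stable if for some small $A_0$ it is $A_0$-invariant and, for every Morley sequence $(\bar a_i\mid i<\alpha)$ in $\mathfrak p$ over $A_0$ with $\alpha$ infinite and every formula $\phi(\bar x)$ over $\bar M$, the set $\{i<\alpha\mid\ \models\phi(\bar a_i)\}$ is finite or co-finite. A non-algebraic $\mathfrak p$ is regular over a small set $A$ if it is $A$-invariant and for every small $B\supseteq A$ and every $\bar a\models\mathfrak p_{\upharpoonright A}$, either $\bar a\models\mathfrak p_{\upharpoonright B}$ or $\mathfrak p_{\upharpoonright B}\vdash\mathfrak p_{\upharpoonright B\bar a}$. Complete types $p(\bar x),q(\bar y)$ over the same set are weakly orthogonal, $p\perp^{w}q$, if $p(\bar x)\cup q(\bar y)$ determines a complete type, i.e. has exactly one completion over that set; global types are orthogonal, $\mathfrak p\perp\mathfrak q$, if they are weakly orthogonal over $\bar M$. Let $A$ be small, let $\mathfrak p$ be a generically stable global type that is regular over $A$, and let $\mathfrak q$ be an $A$-invariant global type. If $\mathfrak p\perp\mathfrak q$, then for every small $C\supseteq A$: (1) $\mathfrak p_{\upharpoonright C}\perp^{w}\mathfrak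 q_{\upharpoonright C}$; (2) $\mathfrak p^{\omega}_{\upharpoonright C}\perp^{w}\mathfrak q^{\omega}_{\upharpoonright C}$. -/

import Mathlib

open FirstOrder FirstOrder.Language Cardinal

universe u v w

namespace InvType

section Basic

variable {L : FirstOrder.Language.{u, v}} {M : Type w} [L.Structure M]

/-- `S_α(A)`: complete types over the parameter set `A ⊆ M` in the variables `α`, i.e. complete
types of the theory of `M` with names for the elements of `A`. -/
abbrev TypeOver (L : FirstOrder.Language.{u, v}) {M : Type w} [L.Structure M] (A : Set M) (α : Type) :=
  (L[[A]].completeTheory M).CompleteType α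

/-- Global types: complete types over the whole structure `M`. -/
abbrev GlobalType (L : FirstOrder.Language.{u, v}) (M : Type w) [L.Structure M] (α : Type) :=
  TypeOver L (Set.univ : Set M) α

/-- The formula `φ`, with parameters in `A`, belongs to the type `p`. -/
def Mem {A : Set M} {α : Type} (φ : L[[A]].Formula α) (p : TypeOver L A α) : Prop :=
  Formula.equivSentence φ ∈ p

/-- A formula with parameters in `A`, regarded as a formula with parameters in `B ⊇ A`. -/
def incl {A B : Set M} {α : Type} (h : A ⊆ B) (φ : L[[A]].Formula α) : L[[B]].Formula α :=
  (L.lhomWithConstantsMap (Set.inclusion h)).onFormula φ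

/-- For `φ(x, y)` with parameters in `A` and a tuple `b` in `B ⊇ A`, the formula `φ(x, b)` with
parameters in `B`. -/
def inst {A B : Set M} {α β : Type} (h : A ⊆ B) (φ : L[[A]].Formula (α ⊕ β)) (b : β → B) :
    L[[B]].Formula α :=
  BoundedFormula.subst (incl h φ) (Sum.elim Term.var fun i => Constants.term (L.con (b i)))

/-- The tuple `a` of elements of `M` realizes the type `p`. -/
def Realizes {A : Set M} {α : Type} (a : α → M) (p : TypeOver L A α) : Prop :=
  ∀ φ : L[[A]].Formula α, Mem φ p → φ.Realize a

/-- The tuples `b` and `c` have the same type over `A`. -/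
def SameType (L : FirstOrder.Language.{u, v}) {M : Type w} [L.Structure M] (A : Set M) {β : Type}
    (b c : β → M) : Prop :=
  ∀ φ : L[[A]].Formula β, φ.Realize b ↔ φ.Realize c

theorem realize_incl {A B : Set M} {α : Type} (h : A ⊆ B) (φ : L[[A]].Formula α) (x : α → M) :
    (incl h φ).Realize x ↔ φ.Realize x :=
  LHom.realize_onFormula _ φ

theorem realize_inst {A B : Set M} {α β : Type} (h : A ⊆ B) (φ : L[[A]].Formula (α ⊕ β))
    (b : β → B) (x : α → M) :
    (inst h φ b).Realize x ↔ φ.Realize (Sum.elim x fun i => (b i : M)) := by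
  rw [inst, Formula.Realize, BoundedFormula.realize_subst, ← realize_incl h φ, Formula.Realize]
  have : (fun a => Term.realize x (Sum.elim Term.var
      (fun i => Constants.term (L.con (b i))) a : L[[B]].Term α)) =
      Sum.elim x fun i => (b i : M) := by
    funext s
    rcases s with s | s
    · rfl
    · simp only [Sum.elim_inr, Term.realize_constants]
      exact coe_con L B
  rw [this]

theorem exists_realization {A : Set M} {α : Type} (p : TypeOver L A α) :
    ∃ (N : Theory.ModelType.{max u w, v, max u v w} (L[[A]].completeTheory M)) (x : α → N),
      ∀ φ : L[[A]].Formula α, Mem φ p ↔ φ.Realize x := by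
  obtain ⟨N, x, rfl⟩ := Theory.exists_modelType_is_realized_in _ p
  exact ⟨N, x, fun φ => Theory.CompleteType.formula_mem_typeOf⟩

theorem exists_restr {α : Type} (p : GlobalType L M α) (A : Set M) :
    ∃ q : TypeOver L A α, ∀ σ : L[[A]][[α]].Sentence,
      σ ∈ q ↔ Mem (incl (Set.subset_univ A) (Formula.equivSentence.symm σ)) p := by
  obtain ⟨N, x, hx⟩ := exists_realization p
  let _ : L[[A]].Structure N :=
    (L.lhomWithConstantsMap (Set.inclusion (Set.subset_univ A))).reduct N
  have _ : N ⊨ L[[A]].completeTheory M := by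
    refine ⟨fun σ hσ => ?_⟩
    have h1 : (L.lhomWithConstantsMap (Set.inclusion (Set.subset_univ A))).onSentence σ ∈
        L[[(Set.univ : Set M)]].completeTheory M := by
      rw [mem_completeTheory, LHom.realize_onSentence]
      exact hσ
    exact (LHom.realize_onSentence N _ σ).1 (N.is_model.realize_of_mem _ h1)
  refine ⟨(L[[A]].completeTheory M).typeOf x, fun σ => ?_⟩
  rw [Theory.CompleteType.mem_typeOf, hx, incl, LHom.realize_onFormula]

/-- The restriction `p ↾ A` of a global type to `A`: the formulas of `p` with parameters in `A`. -/
def restr {α : Type} (p : GlobalType L M α) (A : Set M) : TypeOver L A α where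
  toTheory := {σ | Mem (incl (Set.subset_univ A) (Formula.equivSentence.symm σ)) p}
  subset' := by
    obtain ⟨q, hq⟩ := exists_restr p A
    exact fun σ hσ => (hq σ).1 (q.subset hσ)
  isMaximal' := by
    obtain ⟨q, hq⟩ := exists_restr p A
    have h : {σ | Mem (incl (Set.subset_univ A) (Formula.equivSentence.symm σ)) p} =
        q.toTheory := by
      ext σ
      exact (hq σ).symm
    rw [h]
    exact q.isMaximal

theorem mem_restr {α : Type} (p : GlobalType L M α) (A : Set M) (φ : L[[A]].Formula α) :
    Mem φ (restr p A) ↔ Mem (incl (Set.subset_univ A) φ) p := by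
  change Mem (incl _ (Formula.equivSentence.symm (Formula.equivSentence φ))) p ↔ _
  rw [Equiv.symm_apply_apply]

/-- `p(x) ⊥ʷ q(y)`: the union `p(x) ∪ q(y)` determines a complete type in the variables `x, y`. -/
def WeaklyOrthogonal {A : Set M} {α β : Type} (p : TypeOver L A α) (q : TypeOver L A β) : Prop :=
  ∃! r : TypeOver L A (α ⊕ β),
    (∀ φ : L[[A]].Formula α, Mem φ p → Mem (φ.relabel Sum.inl) r) ∧
    (∀ φ : L[[A]].Formula β, Mem φ q → Mem (φ.relabel Sum.inr) r)

/-- Orthogonality of global types: weak orthogonality over the whole structure. -/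
def Orthogonal {α β : Type} (p : GlobalType L M α) (q : GlobalType L M β) : Prop :=
  WeaklyOrthogonal p q

/-- `p` is `A`-invariant. -/
def InvariantOver {α : Type} (p : GlobalType L M α) (A : Set M) : Prop :=
  ∀ (k : ℕ) (b c : Fin k → M), SameType L A b c → ∀ φ : L[[A]].Formula (α ⊕ Fin k),
    Mem ((inst (Set.subset_univ A) φ fun i => ⟨b i, Set.mem_univ _⟩).iff
      (inst (Set.subset_univ A) φ fun i => ⟨c i, Set.mem_univ _⟩)) p

/-- `(a i)` is a Morley sequence in `p` over `A`: each `a i` realizes the restriction of `p` to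
`A ∪ {a j : j < i}`. -/
def IsMorley {α : Type} {ι : Type*} [LT ι] (p : GlobalType L M α) (A : Set M)
    (a : ι → α → M) : Prop :=
  ∀ i, Realizes (a i) (restr p (A ∪ ⋃ j : {j : ι // j < i}, Set.range (a j)))

/-- `p` is non-algebraic: no formula of `p` has finitely many solutions. -/
def NonAlgebraic {α : Type} (p : GlobalType L M α) : Prop :=
  ∀ φ : L[[(Set.univ : Set M)]].Formula α, Mem φ p → {x : α → M | φ.Realize x}.Infinite

/-- `p` is generically stable, where a set of parameters is small if its cardinality is `< κ`. -/
def GenericallyStable {α : Type} (κ : Cardinal.{w}) (p : GlobalType L M α) : Prop :=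
  NonAlgebraic p ∧ ∃ A : Set M, #A < κ ∧ InvariantOver p A ∧
    ∀ (ι : Type w) [LinearOrder ι] [WellFoundedLT ι] [Infinite ι] (a : ι → α → M),
      IsMorley p A a → ∀ φ : L[[(Set.univ : Set M)]].Formula α,
        {i | φ.Realize (a i)}.Finite ∨ {i | ¬ φ.Realize (a i)}.Finite

/-- `p` is regular over `A`: it is non-algebraic, `A`-invariant, and for every small `B ⊇ A` and
every `a ⊨ p ↾ A`, either `a ⊨ p ↾ B`, or `p ↾ B ⊢ p ↾ Ba`. -/
def RegularOver {α : Type} (κ : Cardinal.{w}) (p : GlobalType L M α) (A : Set M) : Prop :=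
  NonAlgebraic p ∧ InvariantOver p A ∧
    ∀ B : Set M, A ⊆ B → #B < κ → ∀ a : α → M, Realizes a (restr p A) →
      Realizes a (restr p B) ∨
        ∀ c : α → M, Realizes c (restr p B) → Realizes c (restr p (B ∪ Set.range a))

/-- `M` is a monster model with respect to `κ`: `κ` is bigger than the cardinality of the set of
formulas, and `M` is `κ`-saturated and strongly `κ`-homogeneous (elementary maps between subsets
of cardinality `< κ` extend to automorphisms). -/
structure IsMonster (L : FirstOrder.Language.{u, v}) (M : Type w) [L.Structure M]
    (κ : Cardinal.{w}) : Prop where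
  aleph0_lt : ℵ₀ < κ
  card_lt : Cardinal.lift.{w} L.card < Cardinal.lift.{max u v} κ
  saturated : ∀ A : Set M, #A < κ → ∀ (n : ℕ) (p : TypeOver L A (Fin n)), ∃ a, Realizes a p
  homogeneous : ∀ A : Set M, #A < κ → ∀ f : A → M,
    (∀ φ : L.Formula A, φ.Realize (fun x : A => (x : M)) ↔ φ.Realize f) →
      ∃ g : M ≃[L] M, ∀ x : A, g x = f x

end Basic

section Power

variable {L : FirstOrder.Language.{u, v}} {M : Type w} [L.Structure M]

theorem mem_congr {α : Type} [Finite α] {A : Set M} (p : TypeOver L A α)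
    {φ ψ : L[[A]].Formula α} (h : ∀ x : α → M, φ.Realize x ↔ ψ.Realize x) :
    Mem φ p ↔ Mem ψ p := by
  obtain ⟨N, x, hx⟩ := exists_realization p
  let σ : L[[A]].Sentence := Formula.iAlls α ((φ.iff ψ).relabel Sum.inr)
  have h1 : σ ∈ L[[A]].completeTheory M := by
    rw [mem_completeTheory, Sentence.Realize, Formula.realize_iAlls]
    intro i
    rw [Formula.realize_relabel, Formula.realize_iff]
    exact h i
  have h2 := N.is_model.realize_of_mem _ h1
  rw [Sentence.Realize, Formula.realize_iAlls] at h2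
  have h3 := h2 x
  rw [Formula.realize_relabel, Formula.realize_iff] at h3
  rw [hx, hx]
  exact h3

theorem mem_not {α : Type} {A : Set M} (p : TypeOver L A α) (φ : L[[A]].Formula α) :
    Mem φ.not p ↔ ¬ Mem φ p := by
  obtain ⟨N, x, hx⟩ := exists_realization p
  rw [hx, hx, Formula.realize_not]

theorem mem_iff {α : Type} {A : Set M} (p : TypeOver L A α) (φ ψ : L[[A]].Formula α) :
    Mem (φ.iff ψ) p ↔ (Mem φ p ↔ Mem ψ p) := by
  obtain ⟨N, x, hx⟩ := exists_realization p
  rw [hx, hx, hx, Formula.realize_iff]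

theorem realizes_iff {α : Type} {A : Set M} {p : TypeOver L A α} {a : α → M}
    (h : Realizes a p) (φ : L[[A]].Formula α) : φ.Realize a ↔ Mem φ p := by
  refine ⟨fun h1 => ?_, h φ⟩
  by_contra h2
  exact (Formula.realize_not.1 (h _ ((mem_not p φ).2 h2))) h1

theorem realizes_mono {α : Type} {p : GlobalType L M α} {A B : Set M} (h : A ⊆ B)
    [Finite α] {a : α → M} (ha : Realizes a (restr p B)) : Realizes a (restr p A) := by
  intro φ hφ
  rw [← realize_incl h, realizes_iff ha, mem_restr]
  rw [mem_restr] at hφ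
  exact (mem_congr p fun x => by simp only [realize_incl]).1 hφ

theorem isMorley_mono {m : ℕ} {p : GlobalType L M (Fin m)} {A B : Set M} (h : A ⊆ B)
    {a : ℕ → Fin m → M} (ha : IsMorley p B a) : IsMorley p A a := fun i =>
  realizes_mono (Set.union_subset_union_left _ h) (ha i)

theorem realize_iff_mem_inst {m : ℕ} {β : Type} {p : GlobalType L M (Fin m)} {C D : Set M}
    (h : C ⊆ D) {a : Fin m → M} (ha : Realizes a (restr p D)) (φ : L[[C]].Formula (Fin m ⊕ β))
    (b : β → M) (hb : ∀ i, b i ∈ D) :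
    φ.Realize (Sum.elim a b) ↔
      Mem (inst (Set.subset_univ C) φ fun i => ⟨b i, Set.mem_univ _⟩) p := by
  rw [← realize_inst h φ (fun i => ⟨b i, hb i⟩), realizes_iff ha, mem_restr]
  exact mem_congr p fun x => by simp only [realize_incl, realize_inst]

theorem invariant_finite {m : ℕ} {β : Type} [Finite β] {p : GlobalType L M (Fin m)} {C : Set M}
    (hp : InvariantOver p C) {b c : β → M} (hbc : SameType L C b c)
    (φ : L[[C]].Formula (Fin m ⊕ β)) :
    Mem (inst (Set.subset_univ C) φ fun i => ⟨b i, Set.mem_univ _⟩) p ↔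
      Mem (inst (Set.subset_univ C) φ fun i => ⟨c i, Set.mem_univ _⟩) p := by
  obtain ⟨k, ⟨e⟩⟩ := Finite.exists_equiv_fin β
  have h := hp k (b ∘ e.symm) (c ∘ e.symm)
    (fun ψ => by simpa only [Formula.realize_relabel] using hbc (ψ.relabel e.symm))
    (φ.relabel (Sum.map id e))
  rw [mem_iff] at h
  have key : ∀ d : β → M,
      Mem (inst (Set.subset_univ C) φ fun i => ⟨d i, Set.mem_univ _⟩) p ↔
      Mem (inst (Set.subset_univ C) (φ.relabel (Sum.map id e))
        fun i => ⟨(d ∘ e.symm) i, Set.mem_univ _⟩) p := fun d =>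
    mem_congr p fun x => by
      rw [realize_inst, realize_inst, Formula.realize_relabel]
      have : (Sum.elim x (fun i => (d ∘ e.symm) i) ∘ Sum.map id e) = Sum.elim x d := by
        funext s
        rcases s with s | s <;> simp
      rw [this]
  rw [key b, key c]
  exact h

theorem invariantOver_mono {m : ℕ} {p : GlobalType L M (Fin m)} {A B : Set M} (h : A ⊆ B)
    (hp : InvariantOver p A) : InvariantOver p B := by
  intro k b c hbc φ
  have hd : B.Definable L {x : Fin m ⊕ Fin k → M | φ.Realize x} := ⟨φ, rfl⟩
  obtain ⟨F, hF, hd⟩ := Set.definable_iff_finitely_definable.1 hd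
  obtain ⟨χ, hχ⟩ := Set.definable_iff_exists_formula_sum.1 hd
  obtain ⟨n, ⟨e⟩⟩ := Finite.exists_equiv_fin (F : Set M)
  let d : Fin n → M := fun i => e.symm i
  have hdB : ∀ i, d i ∈ B := fun i => hF (e.symm i).2
  let f : (F : Set M) ⊕ (Fin m ⊕ Fin k) → Fin m ⊕ (Fin n ⊕ Fin k) :=
    Sum.elim (fun x => Sum.inr (Sum.inl (e x))) (Sum.map id Sum.inr)
  let θ : L[[A]].Formula (Fin m ⊕ (Fin n ⊕ Fin k)) :=
    (L.lhomWithConstants A).onFormula (χ.relabel f)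
  have key : ∀ g : Fin k → M,
      Mem (inst (Set.subset_univ B) φ fun i => ⟨g i, Set.mem_univ _⟩) p ↔
      Mem (inst (Set.subset_univ A) θ fun i => ⟨Sum.elim d g i, Set.mem_univ _⟩) p := fun g =>
    mem_congr p fun x => by
      rw [realize_inst, realize_inst, LHom.realize_onFormula, Formula.realize_relabel]
      have h1 := Set.ext_iff.1 hχ (Sum.elim x g)
      refine h1.trans ?_
      have : (Sum.elim x (fun i => Sum.elim d g i) ∘ f) =
          Sum.elim (fun y : (F : Set M) => (y : M)) (Sum.elim x g) := by
        funext s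
        rcases s with s | s | s <;> simp [f, d]
      rw [this]
      rfl
  rw [mem_iff, key b, key c]
  refine invariant_finite hp (fun ψ => ?_) θ
  have h2 := hbc (inst h (ψ.relabel Sum.swap) fun i => ⟨d i, hdB i⟩)
  have h3 : ∀ g : Fin k → M, (Sum.elim g d) ∘ Sum.swap = Sum.elim d g := by
    intro g
    funext s
    rcases s with s | s <;> rfl
  rw [realize_inst, realize_inst, Formula.realize_relabel, Formula.realize_relabel,
    h3 b, h3 c] at h2
  exact h2

/-- Two Morley sequences over `C` have the same type over `C`, if `p` is `C`-invariant. -/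
theorem sameType_initial {m : ℕ} {p : GlobalType L M (Fin m)} {C : Set M}
    (hp : InvariantOver p C) {a a' : ℕ → Fin m → M} (ha : IsMorley p C a)
    (ha' : IsMorley p C a') (n : ℕ) :
    SameType L C (fun x : Fin n × Fin m => a x.1 x.2) (fun x : Fin n × Fin m => a' x.1 x.2) := by
  induction n with
  | zero =>
    intro φ
    rw [Subsingleton.elim (fun x : Fin 0 × Fin m => a x.1 x.2) fun x => a' x.1 x.2]
  | succ n ih =>
    intro φ
    let f : Fin (n + 1) × Fin m → Fin m ⊕ (Fin n × Fin m) := fun x =>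
      if h : (x.1 : ℕ) < n then Sum.inr (⟨x.1, h⟩, x.2) else Sum.inl x.2
    have key : ∀ d : ℕ → Fin m → M, IsMorley p C d →
        (φ.Realize (fun x : Fin (n + 1) × Fin m => d x.1 x.2) ↔
          Mem (inst (Set.subset_univ C) (φ.relabel f)
            fun x : Fin n × Fin m => ⟨d x.1 x.2, Set.mem_univ _⟩) p) := by
      intro d hd
      rw [← realize_iff_mem_inst (Set.subset_union_left) (hd n) (φ.relabel f)
        (fun x : Fin n × Fin m => d x.1 x.2)
        (fun x => Or.inr (Set.mem_iUnion.2 ⟨⟨x.1, x.1.2⟩, x.2, rfl⟩)), Formula.realize_relabel]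
      have : (Sum.elim (d n) (fun x : Fin n × Fin m => d x.1 x.2) ∘ f) =
          fun x : Fin (n + 1) × Fin m => d x.1 x.2 := by
        funext x
        by_cases h : (x.1 : ℕ) < n
        · simp [f, h]
        · have : (x.1 : ℕ) = n := by omega
          simp [f, this]
      rw [this]
    rw [key a ha, key a' ha']
    exact invariant_finite hp ih _

theorem sameType_morley {m : ℕ} {p : GlobalType L M (Fin m)} {C : Set M}
    (hp : InvariantOver p C) {a a' : ℕ → Fin m → M} (ha : IsMorley p C a)
    (ha' : IsMorley p C a') :
    SameType L C (fun x : ℕ × Fin m => a x.1 x.2) (fun x : ℕ × Fin m => a' x.1 x.2) := by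
  classical
  intro φ
  let n : ℕ := φ.freeVarFinset.sup fun x => x.1 + 1
  have hn : ∀ x : φ.freeVarFinset, x.1.1 < n := fun x =>
    Finset.le_sup (f := fun x : ℕ × Fin m => x.1 + 1) x.2
  have key : ∀ d : ℕ → Fin m → M,
      (BoundedFormula.restrictFreeVar φ
        fun x => ((⟨x.1.1, hn x⟩, x.1.2) : Fin n × Fin m)).Realize
          (fun x : Fin n × Fin m => d x.1 x.2) default ↔
      φ.Realize (fun x : ℕ × Fin m => d x.1 x.2) := fun d =>
    BoundedFormula.realize_restrictFreeVar _ fun _ => rfl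
  rw [← key a, ← key a']
  exact sameType_initial hp ha ha' n _

theorem small_union {κ : Cardinal.{w}} (hκ : ℵ₀ < κ) {A B : Set M} (hA : #A < κ) (hB : #B < κ) :
    #(A ∪ B : Set M) < κ :=
  (mk_union_le A B).trans_lt (add_lt_of_lt hκ.le hA hB)

theorem small_finset {κ : Cardinal.{w}} (hκ : ℵ₀ < κ) (F : Finset M) :
    #(F : Set M) < κ :=
  (lt_aleph0_of_finite _).trans hκ

theorem exists_morley {κ : Cardinal.{w}} (hM : IsMonster L M κ) {m : ℕ}
    (p : GlobalType L M (Fin m)) {C : Set M} (hC : #C < κ) :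
    ∃ a : ℕ → Fin m → M, IsMorley p C a := by
  have hs : ∀ (n : ℕ) (f : (j : ℕ) → j < n → Fin m → M),
      ∃ b, Realizes b (restr p (C ∪ ⋃ j : {j : ℕ // j < n}, Set.range (f j j.2))) := by
    intro n f
    have hfin : (⋃ j : {j : ℕ // j < n}, Set.range (f j j.2)).Finite :=
      Set.finite_iUnion fun j => Set.finite_range _
    exact hM.saturated _ (small_union hM.aleph0_lt hC
      (hfin.lt_aleph0.trans hM.aleph0_lt)) m _
  choose F hF using hs
  let a : ℕ → Fin m → M := (wellFounded_lt (α := ℕ)).fix F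
  refine ⟨a, fun n => ?_⟩
  have h : a n = F n fun j _ => a j := WellFounded.fix_eq _ F n
  rw [h]
  exact hF n fun j _ => a j

theorem exists_params {γ : Type} (φ : L[[(Set.univ : Set M)]].Formula γ) :
    ∃ (F : Finset M) (ψ : L[[(F : Set M)]].Formula γ),
      ∀ x : γ → M, φ.Realize x ↔ ψ.Realize x := by
  have h : (Set.univ : Set M).Definable L {x : γ → M | φ.Realize x} := ⟨φ, rfl⟩
  obtain ⟨F, -, ψ, hψ⟩ := Set.definable_iff_finitely_definable.1 h
  exact ⟨F, ψ, fun x => Set.ext_iff.1 hψ x⟩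

theorem realize_equivSentence_symm_not {γ : Type} (σ : L[[(Set.univ : Set M)]][[γ]].Sentence)
    (x : γ → M) : (Formula.equivSentence.symm σ.not).Realize x ↔
      ¬ (Formula.equivSentence.symm σ).Realize x := by
  let _ : (constantsOn γ).Structure M := constantsOn.structure x
  rw [Formula.realize_equivSentence_symm, Formula.realize_equivSentence_symm]
  exact Sentence.realize_not M

/-- The power `p^ω` of an invariant global type `p`, in the variables `(x_i)_{i < ω}`: the global
type consisting of the formulas that hold for all Morley sequences of length `ω` in `p` over some
small set of parameters. By `realizes_omegaPower`, its restriction to a small set `C` over which `p`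
is invariant is the type over `C` of any Morley sequence of length `ω` in `p` over `C`. -/
def omegaPower [Nonempty M] {κ : Cardinal.{w}} (hM : IsMonster L M κ) {m : ℕ} (p : GlobalType L M (Fin m))
    (hp : ∃ A : Set M, #A < κ ∧ InvariantOver p A) : GlobalType L M (ℕ × Fin m) where
  toTheory := {σ | ∃ C : Set M, #C < κ ∧ ∀ a : ℕ → Fin m → M, IsMorley p C a →
    (Formula.equivSentence.symm σ).Realize fun x : ℕ × Fin m => a x.1 x.2}
  subset' := by
    rintro _ ⟨τ, hτ, rfl⟩
    refine ⟨∅, by simpa using aleph0_pos.trans hM.aleph0_lt, fun a _ => ?_⟩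
    rw [Formula.realize_equivSentence_symm]
    let _ : (constantsOn (ℕ × Fin m)).Structure M :=
      constantsOn.structure fun x : ℕ × Fin m => a x.1 x.2
    exact (LHom.realize_onSentence M _ τ).2 hτ
  isMaximal' := by
    refine ⟨Theory.isSatisfiable_iff_isFinitelySatisfiable.2 fun T₀ hT₀ => ?_, fun σ => ?_⟩
    · have h : ∃ C : Set M, #C < κ ∧ ∀ a : ℕ → Fin m → M, IsMorley p C a → ∀ σ ∈ T₀,
          (Formula.equivSentence.symm σ).Realize fun x : ℕ × Fin m => a x.1 x.2 := by
        classical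
        induction T₀ using Finset.induction_on with
        | empty => exact ⟨∅, by simpa using aleph0_pos.trans hM.aleph0_lt, by simp⟩
        | insert σ T₁ _ ih =>
          rw [Finset.coe_insert, Set.insert_subset_iff] at hT₀
          obtain ⟨C, hC, h⟩ := ih hT₀.2
          obtain ⟨D, hD, h'⟩ := hT₀.1
          refine ⟨C ∪ D, small_union hM.aleph0_lt hC hD, fun a ha τ hτ => ?_⟩
          rcases Finset.mem_insert.1 hτ with rfl | hτ
          · exact h' a (isMorley_mono Set.subset_union_right ha)
          · exact h a (isMorley_mono Set.subset_union_left ha) τ hτ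
      obtain ⟨C, hC, h⟩ := h
      obtain ⟨a, ha⟩ := exists_morley hM p hC
      let _ : (constantsOn (ℕ × Fin m)).Structure M :=
        constantsOn.structure fun x : ℕ × Fin m => a x.1 x.2
      have _ : M ⊨ (T₀ : L[[(Set.univ : Set M)]][[ℕ × Fin m]].Theory) :=
        ⟨fun σ hσ => (Formula.realize_equivSentence_symm _ _ _).1 (h a ha σ hσ)⟩
      exact Theory.Model.isSatisfiable M
    · obtain ⟨A, hA, hpA⟩ := hp
      obtain ⟨F, ψ, hψ⟩ := exists_params (Formula.equivSentence.symm σ)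
      have hC := small_union hM.aleph0_lt hA (small_finset hM.aleph0_lt F)
      obtain ⟨a, ha⟩ := exists_morley hM p hC
      have key : ∀ b : ℕ → Fin m → M, IsMorley p (A ∪ F) b →
          ((Formula.equivSentence.symm σ).Realize (fun x : ℕ × Fin m => b x.1 x.2) ↔
          (Formula.equivSentence.symm σ).Realize (fun x : ℕ × Fin m => a x.1 x.2)) := by
        intro b hb
        have h := sameType_morley (invariantOver_mono Set.subset_union_left hpA) hb ha
          (incl Set.subset_union_right ψ)
        rw [realize_incl, realize_incl] at h
        rw [hψ, hψ]
        exact h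
      by_cases h : (Formula.equivSentence.symm σ).Realize fun x : ℕ × Fin m => a x.1 x.2
      · exact Or.inl ⟨_, hC, fun b hb => (key b hb).2 h⟩
      · exact Or.inr ⟨_, hC, fun b hb =>
          (realize_equivSentence_symm_not σ _).2 fun h' => h ((key b hb).1 h')⟩

theorem mem_omegaPower [Nonempty M] {κ : Cardinal.{w}} (hM : IsMonster L M κ) {m : ℕ}
    (p : GlobalType L M (Fin m)) (hp : ∃ A : Set M, #A < κ ∧ InvariantOver p A)
    (φ : L[[(Set.univ : Set M)]].Formula (ℕ × Fin m)) :
    Mem φ (omegaPower hM p hp) ↔ ∃ C : Set M, #C < κ ∧ ∀ a : ℕ → Fin m → M, IsMorley p C a →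
      φ.Realize fun x : ℕ × Fin m => a x.1 x.2 := by
  change (∃ C : Set M, #C < κ ∧ ∀ a : ℕ → Fin m → M, IsMorley p C a →
    (Formula.equivSentence.symm (Formula.equivSentence φ)).Realize
      fun x : ℕ × Fin m => a x.1 x.2) ↔ _
  rw [Equiv.symm_apply_apply]

theorem realizes_omegaPower [Nonempty M] {κ : Cardinal.{w}} (hM : IsMonster L M κ) {m : ℕ}
    (p : GlobalType L M (Fin m)) (hp : ∃ A : Set M, #A < κ ∧ InvariantOver p A) {C : Set M}
    (hC : #C < κ) (hpC : InvariantOver p C) {a : ℕ → Fin m → M} (ha : IsMorley p C a) :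
    Realizes (fun x : ℕ × Fin m => a x.1 x.2) (restr (omegaPower hM p hp) C) := by
  intro φ hφ
  rw [mem_restr, mem_omegaPower] at hφ
  obtain ⟨D, hD, h⟩ := hφ
  obtain ⟨b, hb⟩ := exists_morley hM p (small_union hM.aleph0_lt hC hD)
  have h1 := h b (isMorley_mono Set.subset_union_right hb)
  rw [realize_incl] at h1
  exact (sameType_morley hpC ha (isMorley_mono Set.subset_union_left hb) φ).2 h1

end Power

end InvType

/-! The heart is `sameType_elim_of_orthogonal`: over `A`, all pairs of realizations of `p ↾ A` and
`q ↾ A` have the same type. Let `Z` be definable over `A`. By compactness, orthogonality gives `X`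
in `p` and `Y` in `q`, with parameters possibly outside `A`, such that `X × Y` lies inside `Z` or
misses it (`Orthogonal.exists_contains`). After passing to the complement, suppose that it misses
`Z` while some pair realizing `p ↾ A` and `q ↾ A` lies in `Z`.

A Morley sequence of `p` over `A` is then built together with conjugates `g i X` over `A`, such that
`g i X` contains the terms up to `i` and omits the later ones (`exists_morley_cut`). The next term
must be related by `Z` to some `b` generic in `q` over everything built so far: since `b` lies in
each `g j Y`, the term is outside each earlier `g j X`. That it can also continue the Morley
sequence is `exists_realizes_union_initial`. There a candidate `x` that is not generic over the
sequence is, by regularity, harmless to a fresh Morley sequence `c`; symmetry of generically stable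
types makes `x` generic over `c`, and `c` is conjugate to the old sequence by an automorphism fixing
`b`. Such cuts of every finite length produce, by saturation, a definable set splitting a Morley
sequence of length `ω + ω`, against generic stability.

For the powers, uniqueness of the type of a pair says that realizations of `p ↾ A` and `q ↾ A` are
independent of each other. As the hypotheses survive enlarging `A`, this propagates term by term
through Morley sequences, so that any two pairs of finite ones are conjugate; a formula mentions
only finitely many variables. -/

namespace InvType

/-! ### Automorphisms, definable sets and compactness in a monster model -/

section Interface

variable {L : FirstOrder.Language.{u, v}} {M : Type w} [L.Structure M]

/-- A set is definable over `B` iff it is defined by an instance of a formula without parameters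
at a finite tuple from `B`. -/
theorem definable_iff_exists_tuple {B : Set M} {α : Type} {X : Set (α → M)} :
    B.Definable L X ↔ ∃ (k : ℕ) (θ : L.Formula (α ⊕ Fin k)) (e : Fin k → M),
      (∀ i, e i ∈ B) ∧ ∀ x, x ∈ X ↔ θ.Realize (Sum.elim x e) := by
  constructor
  · intro h
    obtain ⟨F, hF, hd⟩ := Set.definable_iff_finitely_definable.1 h
    obtain ⟨χ, hχ⟩ := Set.definable_iff_exists_formula_sum.1 hd
    obtain ⟨n, ⟨e⟩⟩ := Finite.exists_equiv_fin (F : Set M)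
    refine ⟨n, χ.relabel (Sum.elim (fun x => Sum.inr (e x)) Sum.inl), fun i => e.symm i,
      fun i => hF (e.symm i).2, fun x => ?_⟩
    rw [hχ, Formula.realize_relabel]
    have : (Sum.elim x (fun i => ((e.symm i : (F : Set M)) : M)) ∘
        Sum.elim (fun y => Sum.inr (e y)) Sum.inl) =
        Sum.elim (fun y : (F : Set M) => (y : M)) x := by
      funext s
      rcases s with s | s <;> simp
    rw [this]
    rfl
  · rintro ⟨k, θ, e, he, hX⟩
    refine Set.definable_iff_exists_formula_sum.2
      ⟨θ.relabel (Sum.elim Sum.inr fun i => Sum.inl ⟨e i, he i⟩), ?_⟩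
    ext x
    rw [hX, Set.mem_ofPred_eq, Formula.realize_relabel]
    have : (Sum.elim (fun y : B => (y : M)) x ∘
        Sum.elim Sum.inr fun i => Sum.inl ⟨e i, he i⟩) = Sum.elim x e := by
      funext s
      rcases s with s | s <;> simp
    rw [← this]

/-- The automorphism `g` fixes `A` pointwise. -/
def Fixes (g : M ≃[L] M) (A : Set M) : Prop := ∀ x ∈ A, g x = x

theorem Fixes.mono {g : M ≃[L] M} {A B : Set M} (h : Fixes g B) (hAB : A ⊆ B) : Fixes g A :=
  fun x hx => h x (hAB hx)

theorem Fixes.symm {g : M ≃[L] M} {A : Set M} (h : Fixes g A) : Fixes g.symm A := fun x hx => by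
  conv_lhs => rw [← h x hx]
  exact g.symm_apply_apply x

theorem Fixes.comp {g h : M ≃[L] M} {A : Set M} (hh : Fixes h A) (hg : Fixes g A) :
    Fixes (h.comp g) A := fun x hx => by
  rw [Language.Equiv.comp_apply, hg x hx, hh x hx]

theorem Fixes.image_eq {g : M ≃[L] M} {A : Set M} (h : Fixes g A) : g '' A = A := by
  ext x
  constructor
  · rintro ⟨y, hy, rfl⟩
    rwa [h y hy]
  · exact fun hx => ⟨x, hx, h x hx⟩

theorem realize_comp_equiv {α : Type*} (g : M ≃[L] M) (φ : L.Formula α) (x : α → M) :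
    φ.Realize (g ∘ x) ↔ φ.Realize x :=
  StrongHomClass.realize_formula g φ

/-- Automorphisms fixing the parameters preserve formulas. -/
theorem Fixes.realize_iff {g : M ≃[L] M} {A : Set M} (h : Fixes g A) {α : Type}
    (φ : L[[A]].Formula α) (x : α → M) : φ.Realize (g ∘ x) ↔ φ.Realize x := by
  obtain ⟨k, θ, e, he, hX⟩ :=
    definable_iff_exists_tuple.1 (⟨φ, rfl⟩ : A.Definable L {x | φ.Realize x})
  have hX' : ∀ x, φ.Realize x ↔ θ.Realize (Sum.elim x e) := hX
  rw [hX', hX', ← realize_comp_equiv g θ (Sum.elim x e), Sum.comp_elim]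
  have : g ∘ e = e := funext fun i => h _ (he i)
  rw [this]

theorem Fixes.sameType {g : M ≃[L] M} {A : Set M} (h : Fixes g A) {β : Type} (b : β → M) :
    SameType L A b (g ∘ b) := fun φ => (h.realize_iff φ b).symm

/-- Finite tuples of the same type over a small set are conjugate over it. -/
theorem exists_fixes_comp_eq {κ : Cardinal.{w}} (hM : IsMonster L M κ) {A : Set M} (hA : #A < κ)
    {β : Type} [Finite β] {b c : β → M} (h : SameType L A b c) :
    ∃ g : M ≃[L] M, Fixes g A ∧ g ∘ b = c := by
  classical
  let B : Set M := A ∪ Set.range b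
  have hB : #B < κ := small_union hM.aleph0_lt hA
    ((Set.finite_range b).lt_aleph0.trans hM.aleph0_lt)
  -- `t x` names `x` by a variable evaluated at `b` or by a constant from `A`. Evaluating the same
  -- names at `c` gives the elementary map to be extended.
  let t : B → L[[A]].Term β := fun x =>
    if hx : ∃ i, b i = x then Term.var hx.choose
    else Constants.term (L.con (⟨x, x.2.resolve_right hx⟩ : A))
  have ht : ∀ x : B, (t x).realize b = (x : M) := by
    intro x
    by_cases hx : ∃ i, b i = x
    · simp only [t, dif_pos hx, Term.realize_var]
      exact hx.choose_spec
    · simp only [t, dif_neg hx, Term.realize_constants]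
      exact coe_con L A
  obtain ⟨g, hg⟩ := hM.homogeneous B hB (fun x => (t x).realize c) fun φ => by
    have h1 := h (BoundedFormula.subst ((L.lhomWithConstants A).onFormula φ) t)
    simp only [Formula.Realize, BoundedFormula.realize_subst] at h1
    have h2 : ∀ d : β → M, ((L.lhomWithConstants A).onFormula φ).Realize
        (fun x => (t x).realize d) ↔ φ.Realize fun x => (t x).realize d := fun d =>
      LHom.realize_onFormula _ φ
    have h3 := (h2 b).symm.trans (h1.trans (h2 c))
    simpa only [ht] using h3
  -- An element may have several names: `b` can have repeated entries or entries in `A`. Equality of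
  -- types makes the image independent of the name chosen in `t`.
  have key : ∀ (s : L[[A]].Term β) (x : B), s.realize b = x → s.realize c = g x := by
    intro s x hs
    have h1 := h (Term.equal s (t x))
    rw [Formula.realize_equal, Formula.realize_equal, ht] at h1
    rw [hg]
    exact h1.1 hs
  refine ⟨g, fun x hx => ?_, funext fun i => ?_⟩
  · have h1 := key (Constants.term (L.con (⟨x, hx⟩ : A))) ⟨x, Or.inl hx⟩
    simp only [Term.realize_constants] at h1
    have h2 : ((L.con (⟨x, hx⟩ : A) : L[[A]].Constants) : M) = x := coe_con L A
    rw [h2] at h1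
    exact (h1 rfl).symm
  · exact (key (Term.var i) ⟨b i, Or.inr ⟨i, rfl⟩⟩ rfl).symm

/-- The definable set `X` belongs to the global type `p`. -/
def Contains {α : Type} (p : GlobalType L M α) (X : Set (α → M)) : Prop :=
  ∃ φ : L[[(Set.univ : Set M)]].Formula α, (∀ x, φ.Realize x ↔ x ∈ X) ∧ Mem φ p

theorem contains_iff {α : Type} [Finite α] {p : GlobalType L M α} {X : Set (α → M)}
    {φ : L[[(Set.univ : Set M)]].Formula α} (h : ∀ x, φ.Realize x ↔ x ∈ X) :
    Contains p X ↔ Mem φ p :=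
  ⟨fun ⟨_, hψ, hm⟩ => (mem_congr p fun x => (hψ x).trans (h x).symm).1 hm, fun hm => ⟨φ, h, hm⟩⟩

/-- Membership in a type depends only on the set a formula defines, so from here on restrictions are
handled through definable sets instead of syntax. -/
theorem realizes_restr_iff {α : Type} [Finite α] {p : GlobalType L M α} {B : Set M} {a : α → M} :
    Realizes a (restr p B) ↔ ∀ X, B.Definable L X → Contains p X → a ∈ X := by
  constructor
  · rintro h X ⟨φ, rfl⟩ hp
    refine h φ ((mem_restr p B φ).2 ((contains_iff fun x => ?_).1 hp))
    rw [realize_incl]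
    rfl
  · intro h φ hφ
    exact h {x | φ.Realize x} ⟨φ, rfl⟩
      ((contains_iff fun x => realize_incl (Set.subset_univ B) φ x).2 ((mem_restr p B φ).1 hφ))

theorem sameType_of_realizes {α : Type} [Finite α] {p : GlobalType L M α} {B : Set M}
    {a a' : α → M} (h : Realizes a (restr p B)) (h' : Realizes a' (restr p B)) :
    SameType L B a a' := fun φ => by rw [realizes_iff h, realizes_iff h']

/-- The image of a set of tuples under an automorphism. -/
def move {α : Type} (g : M ≃[L] M) (X : Set (α → M)) : Set (α → M) := {x | g.symm ∘ x ∈ X}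

theorem comp_mem_move {α : Type} (g : M ≃[L] M) (X : Set (α → M)) (x : α → M) :
    g ∘ x ∈ move g X ↔ x ∈ X := by
  have : g.symm ∘ g ∘ x = x := funext fun i => g.symm_apply_apply (x i)
  rw [move, Set.mem_ofPred_eq, this]

theorem mem_move_iff {α : Type} (g : M ≃[L] M) {X : Set (α → M)} {k : ℕ}
    {θ : L.Formula (α ⊕ Fin k)} {e : Fin k → M} (h : ∀ x, x ∈ X ↔ θ.Realize (Sum.elim x e))
    (x : α → M) : x ∈ move g X ↔ θ.Realize (Sum.elim x (g ∘ e)) := by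
  have : g ∘ g.symm ∘ x = x := funext fun i => g.apply_symm_apply (x i)
  rw [move, Set.mem_ofPred_eq, h, ← realize_comp_equiv g, Sum.comp_elim, this]

theorem definable_move {α : Type} (g : M ≃[L] M) {B : Set M} {X : Set (α → M)}
    (h : B.Definable L X) : (g '' B).Definable L (move g X) := by
  obtain ⟨k, θ, e, he, hX⟩ := definable_iff_exists_tuple.1 h
  exact definable_iff_exists_tuple.2
    ⟨k, θ, g ∘ e, fun i => ⟨e i, he i, rfl⟩, mem_move_iff g hX⟩

theorem Fixes.comp_mem_iff {g : M ≃[L] M} {B : Set M} (hg : Fixes g B) {α : Type}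
    {X : Set (α → M)} (hX : B.Definable L X) (x : α → M) : g ∘ x ∈ X ↔ x ∈ X := by
  obtain ⟨φ, rfl⟩ := hX
  exact hg.realize_iff φ x

/-- Moving `X` replaces its parameter tuple `e` by `g ∘ e`, which has the same type over `A`. -/
theorem InvariantOver.contains_move {m : ℕ} {p : GlobalType L M (Fin m)} {A : Set M}
    (hp : InvariantOver p A) {g : M ≃[L] M} (hg : Fixes g A) {B : Set M} {X : Set (Fin m → M)}
    (hX : B.Definable L X) : Contains p (move g X) ↔ Contains p X := by
  obtain ⟨k, θ, e, -, hX⟩ := definable_iff_exists_tuple.1 hX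
  have h := invariant_finite hp (hg.sameType e) ((L.lhomWithConstants A).onFormula θ)
  have h1 : ∀ (d : Fin k → M) (x : Fin m → M), (inst (Set.subset_univ A)
      ((L.lhomWithConstants A).onFormula θ) fun i => ⟨d i, Set.mem_univ _⟩).Realize x ↔
      θ.Realize (Sum.elim x d) := fun d x => by
    rw [realize_inst, LHom.realize_onFormula]
  rw [contains_iff fun x => (h1 e x).trans (hX x).symm, h,
    contains_iff fun x => (h1 (g ∘ e) x).trans (mem_move_iff g hX x).symm]

/-- Automorphisms over `A` preserve realizations of restrictions of `A`-invariant types. -/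
theorem InvariantOver.realizes_comp {m : ℕ} {p : GlobalType L M (Fin m)} {A : Set M}
    (hp : InvariantOver p A) {g : M ≃[L] M} (hg : Fixes g A) {B : Set M} {a : Fin m → M}
    (ha : Realizes a (restr p B)) : Realizes (g ∘ a) (restr p (g '' B)) := by
  rw [realizes_restr_iff] at ha ⊢
  intro X hX hpX
  have h1 := definable_move g.symm hX
  have h2 : g.symm '' (g '' B) = B := by
    rw [← Set.image_comp]
    exact (Set.image_congr fun x _ => g.symm_apply_apply x).trans (Set.image_id B)
  rw [h2] at h1
  have h3 := ha _ h1 ((hp.contains_move hg.symm hX).2 hpX)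
  have h4 : g.symm ∘ g ∘ a = a := funext fun i => g.symm_apply_apply (a i)
  rw [← h4] at h3
  exact (comp_mem_move g.symm X _).1 h3

/-- A set of formulas which is finitely satisfiable in `M` extends to a complete type. -/
theorem exists_type_of_finitely_satisfiable [Nonempty M] {A : Set M} {α : Type}
    (S : Set (L[[A]].Formula α))
    (h : ∀ S₀ : Finset (L[[A]].Formula α), ↑S₀ ⊆ S → ∃ x : α → M, ∀ φ ∈ S₀, φ.Realize x) :
    ∃ r : TypeOver L A α, ∀ φ ∈ S, Mem φ r := by
  classical
  let T : L[[A]][[α]].Theory := ((L[[A]]).lhomWithConstants α).onTheory (L[[A]].completeTheory M)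
  let S' : L[[A]][[α]].Theory := Formula.equivSentence '' S
  have hs : (T ∪ S').IsSatisfiable := by
    refine Theory.isSatisfiable_iff_isFinitelySatisfiable.2 fun T₀ hT₀ => ?_
    obtain ⟨x, hx⟩ := h ((T₀.image Formula.equivSentence.symm).filter (· ∈ S)) fun φ hφ => by
      simpa using (Finset.mem_filter.1 (Finset.mem_coe.1 hφ)).2
    let _ : (constantsOn α).Structure M := constantsOn.structure x
    have _ : M ⊨ (T₀ : L[[A]][[α]].Theory) := by
      refine ⟨fun σ hσ => ?_⟩
      rcases hT₀ hσ with ⟨τ, hτ, rfl⟩ | ⟨φ, hφ, rfl⟩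
      · exact (LHom.realize_onSentence M _ τ).2 hτ
      · rw [Formula.realize_equivSentence]
        exact hx φ (Finset.mem_filter.2 ⟨Finset.mem_image.2 ⟨_, hσ, by simp⟩, hφ⟩)
    exact Theory.Model.isSatisfiable M
  by_contra hc
  have h1 := (Theory.CompleteType.setOfPred_subset_eq_empty_iff
    (T := L[[A]].completeTheory M) S').1
  refine h1 (Set.eq_empty_iff_forall_notMem.2 fun r hr => hc ⟨r, fun φ hφ => ?_⟩) hs
  exact hr ⟨φ, hφ, rfl⟩

/-- In a monster model the restriction of a type over a small set to finitely many variables is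
realized. -/
theorem exists_realize_iff_mem_relabel {κ : Cardinal.{w}} (hM : IsMonster L M κ) {C : Set M}
    (hC : #C < κ) {γ δ : Type} [Finite δ] (r : TypeOver L C γ) (f : δ → γ) :
    ∃ a : δ → M, ∀ ψ : L[[C]].Formula δ, ψ.Realize a ↔ Mem (ψ.relabel f) r := by
  obtain ⟨N, x, hx⟩ := exists_realization r
  obtain ⟨k, ⟨e⟩⟩ := Finite.exists_equiv_fin δ
  let s : TypeOver L C (Fin k) := (L[[C]].completeTheory M).typeOf (x ∘ f ∘ e.symm)
  obtain ⟨b, hb⟩ := hM.saturated C hC k s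
  refine ⟨b ∘ e, fun ψ => ?_⟩
  rw [← Formula.realize_relabel, realizes_iff hb, hx, Formula.realize_relabel]
  refine Theory.CompleteType.formula_mem_typeOf.trans ?_
  rw [Formula.realize_relabel]
  have : (x ∘ f ∘ e.symm) ∘ e = x ∘ f := by
    funext i
    simp
  rw [this]

/-- Saturation, for sets definable over a small set. -/
theorem exists_mem_of_finite_inter [Nonempty M] {κ : Cardinal.{w}} (hM : IsMonster L M κ)
    {B : Set M} (hB : #B < κ) {k : ℕ} (S : ℕ → Set (Fin k → M)) (hS : ∀ i, B.Definable L (S i))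
    (h : ∀ N, ∃ x, ∀ i < N, x ∈ S i) : ∃ x, ∀ i, x ∈ S i := by
  classical
  choose φ hφ using hS
  have hφ' : ∀ i x, (φ i).Realize x ↔ x ∈ S i := fun i x => by rw [hφ]; rfl
  obtain ⟨r, hr⟩ := exists_type_of_finitely_satisfiable (Set.range φ) fun S₀ hS₀ => by
    obtain ⟨I, hI⟩ := Finset.subset_set_image_iff.1
      (show (S₀ : Set _) ⊆ φ '' Set.univ by rwa [Set.image_univ])
    obtain ⟨x, hx⟩ := h (I.sup id + 1)
    refine ⟨x, fun ψ hψ => ?_⟩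
    rw [← hI.2] at hψ
    obtain ⟨i, hi, rfl⟩ := Finset.mem_image.1 hψ
    exact (hφ' i x).2 (hx i (Nat.lt_succ_of_le (Finset.le_sup (f := id) hi)))
  obtain ⟨x, hx⟩ := hM.saturated B hB k r
  exact ⟨x, fun i => (hφ' i x).1 (hx _ (hr _ ⟨i, rfl⟩))⟩

theorem contains_forall_mem_finset {α : Type} [Finite α] {p : GlobalType L M α}
    (s : Finset (L[[(Set.univ : Set M)]].Formula α)) (h : ∀ φ ∈ s, Mem φ p) :
    Contains p {x | ∀ φ ∈ s, φ.Realize x} := by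
  obtain ⟨N, x, hx⟩ := exists_realization p
  refine ⟨BoundedFormula.iInf fun φ : s => φ.1, fun y => ?_, (hx _).2 ?_⟩
  · simp [Formula.Realize]
  · simp only [Formula.Realize, BoundedFormula.realize_iInf]
    exact fun φ => (hx _).1 (h _ φ.2)

/-- Orthogonal global types separate definable relations by rectangles. -/
theorem Orthogonal.exists_contains [Nonempty M] {α β : Type} [Finite α] [Finite β]
    {p : GlobalType L M α}
    {q : GlobalType L M β} (h : Orthogonal p q) {B : Set M} {Z : Set (α ⊕ β → M)}
    (hZ : B.Definable L Z) :
    ∃ X Y, (Set.univ : Set M).Definable L X ∧ (Set.univ : Set M).Definable L Y ∧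
      Contains p X ∧ Contains q Y ∧
      ((∀ x ∈ X, ∀ y ∈ Y, Sum.elim x y ∈ Z) ∨ (∀ x ∈ X, ∀ y ∈ Y, Sum.elim x y ∉ Z)) := by
  classical
  by_contra hc
  push Not at hc
  obtain ⟨φ, hφ⟩ := hZ.mono (Set.subset_univ B)
  have hφ' : ∀ z, φ.Realize z ↔ z ∈ Z := fun z => by rw [hφ]; rfl
  -- If `ψ` meets every rectangle from `p` and `q`, it is consistent with their union. Without a
  -- separating rectangle this applies to both `φ` and its negation, giving two completions.
  have key : ∀ ψ : L[[(Set.univ : Set M)]].Formula (α ⊕ β),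
      (∀ X Y, (Set.univ : Set M).Definable L X → (Set.univ : Set M).Definable L Y →
        Contains p X → Contains q Y → ∃ x ∈ X, ∃ y ∈ Y, ψ.Realize (Sum.elim x y)) →
      ∃ r : GlobalType L M (α ⊕ β), Mem ψ r ∧
        (∀ φ : L[[(Set.univ : Set M)]].Formula α, Mem φ p → Mem (φ.relabel Sum.inl) r) ∧
        (∀ φ : L[[(Set.univ : Set M)]].Formula β, Mem φ q → Mem (φ.relabel Sum.inr) r) := by
    intro ψ hψ
    let S₁ : Set (L[[(Set.univ : Set M)]].Formula (α ⊕ β)) :=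
      Formula.relabel Sum.inl '' {φ | Mem φ p}
    let S₂ : Set (L[[(Set.univ : Set M)]].Formula (α ⊕ β)) :=
      Formula.relabel Sum.inr '' {φ | Mem φ q}
    obtain ⟨r, hr⟩ := exists_type_of_finitely_satisfiable (insert ψ (S₁ ∪ S₂)) fun S₀ hS₀ => by
      have hS₁ : (↑(S₀.filter (· ∈ S₁)) : Set (L[[(Set.univ : Set M)]].Formula (α ⊕ β))) ⊆
          Formula.relabel Sum.inl '' {φ | Mem φ p} := fun φ hφ => (Finset.mem_filter.1 hφ).2
      have hS₂ : (↑(S₀.filter (· ∈ S₂)) : Set (L[[(Set.univ : Set M)]].Formula (α ⊕ β))) ⊆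
          Formula.relabel Sum.inr '' {φ | Mem φ q} := fun φ hφ => (Finset.mem_filter.1 hφ).2
      obtain ⟨I, hI, hI'⟩ := Finset.subset_set_image_iff.1 hS₁
      obtain ⟨J, hJ, hJ'⟩ := Finset.subset_set_image_iff.1 hS₂
      have h1 := contains_forall_mem_finset I hI
      have h2 := contains_forall_mem_finset J hJ
      have h1' := h1
      have h2' := h2
      obtain ⟨θ₁, hθ₁, -⟩ := h1'
      obtain ⟨θ₂, hθ₂, -⟩ := h2'
      obtain ⟨x, hx, y, hy, hxy⟩ := hψ _ _ ⟨θ₁, Set.ext fun x => (hθ₁ x).symm⟩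
        ⟨θ₂, Set.ext fun x => (hθ₂ x).symm⟩ h1 h2
      refine ⟨Sum.elim x y, fun χ hχ => ?_⟩
      rcases hS₀ hχ with rfl | hχ' | hχ'
      · exact hxy
      · have : χ ∈ S₀.filter (· ∈ S₁) := Finset.mem_filter.2 ⟨hχ, hχ'⟩
        rw [← hI'] at this
        obtain ⟨χ, hm, rfl⟩ := Finset.mem_image.1 this
        rw [Formula.realize_relabel, Sum.elim_comp_inl]
        exact hx χ hm
      · have : χ ∈ S₀.filter (· ∈ S₂) := Finset.mem_filter.2 ⟨hχ, hχ'⟩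
        rw [← hJ'] at this
        obtain ⟨χ, hm, rfl⟩ := Finset.mem_image.1 this
        rw [Formula.realize_relabel, Sum.elim_comp_inr]
        exact hy χ hm
    exact ⟨r, hr _ (Or.inl rfl), fun χ hχ => hr _ (Or.inr (Or.inl ⟨χ, hχ, rfl⟩)),
      fun χ hχ => hr _ (Or.inr (Or.inr ⟨χ, hχ, rfl⟩))⟩
  obtain ⟨r₁, h₁, hr₁⟩ := key φ fun X Y hX hY hpX hqY => by
    obtain ⟨x, hx, y, hy, hz⟩ := (hc X Y hX hY hpX hqY).2
    exact ⟨x, hx, y, hy, (hφ' _).2 hz⟩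
  obtain ⟨r₂, h₂, hr₂⟩ := key φ.not fun X Y hX hY hpX hqY => by
    obtain ⟨x, hx, y, hy, hz⟩ := (hc X Y hX hY hpX hqY).1
    exact ⟨x, hx, y, hy, Formula.realize_not.2 fun h => hz ((hφ' _).1 h)⟩
  rw [h.unique hr₁ hr₂] at h₁
  exact (mem_not r₂ φ).1 h₂ h₁

end Interface

/-! ### Finite Morley sequences and their conjugacy -/

section Morley

variable {L : FirstOrder.Language.{u, v}} {M : Type w} [L.Structure M]

/-- The elements occurring in the first `n` terms of a sequence of tuples. -/
def initial {m : ℕ} (a : ℕ → Fin m → M) (n : ℕ) : Set M :=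
  ⋃ j : {j : ℕ // j < n}, Set.range (a j)

theorem mem_initial {m : ℕ} {a : ℕ → Fin m → M} {n : ℕ} {x : M} :
    x ∈ initial a n ↔ ∃ j < n, ∃ s, a j s = x := by
  simp only [initial, Set.mem_iUnion, Set.mem_range, Subtype.exists, exists_prop]

theorem initial_zero {m : ℕ} (a : ℕ → Fin m → M) : initial a 0 = ∅ :=
  Set.eq_empty_iff_forall_notMem.2 fun x hx => by
    obtain ⟨j, hj, -⟩ := mem_initial.1 hx
    exact absurd hj (Nat.not_lt_zero j)

theorem initial_succ {m : ℕ} (a : ℕ → Fin m → M) (n : ℕ) :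
    initial a (n + 1) = initial a n ∪ Set.range (a n) := by
  ext x
  simp only [Set.mem_union, mem_initial, Set.mem_range]
  constructor
  · rintro ⟨j, hj, s, rfl⟩
    rcases Nat.lt_succ_iff_lt_or_eq.1 hj with hj | rfl
    · exact Or.inl ⟨j, hj, s, rfl⟩
    · exact Or.inr ⟨s, rfl⟩
  · rintro (⟨j, hj, s, rfl⟩ | ⟨s, rfl⟩)
    · exact ⟨j, hj.trans (Nat.lt_succ_self n), s, rfl⟩
    · exact ⟨n, Nat.lt_succ_self n, s, rfl⟩

theorem initial_congr {m : ℕ} {a a' : ℕ → Fin m → M} {n : ℕ} (h : ∀ i < n, a i = a' i) :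
    initial a n = initial a' n := by
  ext x
  simp only [mem_initial]
  exact exists_congr fun j => and_congr_right fun hj => by rw [h j hj]

theorem image_initial {m : ℕ} (g : M ≃[L] M) (a : ℕ → Fin m → M) (n : ℕ) :
    g '' initial a n = initial (fun i => g ∘ a i) n := by
  ext x
  simp only [Set.mem_image, mem_initial]
  constructor
  · rintro ⟨_, ⟨j, hj, s, rfl⟩, rfl⟩
    exact ⟨j, hj, s, rfl⟩
  · rintro ⟨j, hj, s, rfl⟩
    exact ⟨_, ⟨j, hj, s, rfl⟩, rfl⟩

theorem initial_small {κ : Cardinal.{w}} (hM : IsMonster L M κ) {m : ℕ} (a : ℕ → Fin m → M)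
    (n : ℕ) : #(initial a n) < κ :=
  (Set.finite_iUnion fun _ => Set.finite_range _).lt_aleph0.trans hM.aleph0_lt

theorem range_small {κ : Cardinal.{w}} (hM : IsMonster L M κ) {m : ℕ} (a : Fin m → M) :
    #(Set.range a) < κ :=
  (Set.finite_range a).lt_aleph0.trans hM.aleph0_lt

theorem iUnion_range_small {κ : Cardinal.{w}} (hM : IsMonster L M κ) {m : ℕ}
    (a : ℕ → Fin m → M) : #(⋃ i, Set.range (a i)) < κ :=
  (Set.countable_iUnion fun i => Set.countable_range (a i)).le_aleph0.trans_lt hM.aleph0_lt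

/-- The first `n` terms of `a` form a Morley sequence in `p` over `A`. -/
def MorleyUpTo {m : ℕ} (p : GlobalType L M (Fin m)) (A : Set M) (a : ℕ → Fin m → M) (n : ℕ) :
    Prop :=
  ∀ i < n, Realizes (a i) (restr p (A ∪ initial a i))

theorem IsMorley.upTo {m : ℕ} {p : GlobalType L M (Fin m)} {A : Set M} {a : ℕ → Fin m → M}
    (h : IsMorley p A a) (n : ℕ) : MorleyUpTo p A a n := fun i _ => h i

theorem MorleyUpTo.mono {m : ℕ} {p : GlobalType L M (Fin m)} {A B : Set M} {a : ℕ → Fin m → M}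
    {n : ℕ} (h : MorleyUpTo p B a n) (hAB : A ⊆ B) : MorleyUpTo p A a n := fun i hi =>
  realizes_mono (Set.union_subset_union_left _ hAB) (h i hi)

theorem MorleyUpTo.congr {m : ℕ} {p : GlobalType L M (Fin m)} {A : Set M} {a a' : ℕ → Fin m → M}
    {n : ℕ} (h : MorleyUpTo p A a n) (haa' : ∀ i < n, a i = a' i) : MorleyUpTo p A a' n :=
  fun i hi => by
    rw [← haa' i hi, ← initial_congr fun j hj => haa' j (hj.trans hi)]
    exact h i hi

theorem MorleyUpTo.comp {m : ℕ} {p : GlobalType L M (Fin m)} {A B : Set M} {a : ℕ → Fin m → M}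
    {n : ℕ} (h : MorleyUpTo p B a n) (hp : InvariantOver p A) {g : M ≃[L] M} (hg : Fixes g A) :
    MorleyUpTo p (g '' B) (fun i => g ∘ a i) n := fun i hi => by
  have h1 := hp.realizes_comp hg (h i hi)
  rwa [Set.image_union, image_initial] at h1

theorem exists_fixes_of_realizes {κ : Cardinal.{w}} (hM : IsMonster L M κ) {m : ℕ}
    {p : GlobalType L M (Fin m)} {B : Set M} (hB : #B < κ) {a a' : Fin m → M}
    (h : Realizes a (restr p B)) (h' : Realizes a' (restr p B)) :
    ∃ g : M ≃[L] M, Fixes g B ∧ g ∘ a = a' :=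
  exists_fixes_comp_eq hM hB (sameType_of_realizes h h')

/-- Morley sequences of the same finite length are conjugate. -/
theorem MorleyUpTo.exists_fixes {κ : Cardinal.{w}} (hM : IsMonster L M κ) {m : ℕ}
    {p : GlobalType L M (Fin m)} {A : Set M} (hA : #A < κ) (hp : InvariantOver p A) {n : ℕ}
    {a a' : ℕ → Fin m → M} (h : MorleyUpTo p A a n) (h' : MorleyUpTo p A a' n) :
    ∃ g : M ≃[L] M, Fixes g A ∧ ∀ i < n, g ∘ a i = a' i := by
  induction n with
  | zero =>
    exact ⟨Language.Equiv.refl L M, fun x _ => rfl, fun i hi => absurd hi (Nat.not_lt_zero i)⟩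
  | succ n ih =>
    obtain ⟨g, hg, hga⟩ := ih (fun i hi => h i (hi.trans (Nat.lt_succ_self n)))
      fun i hi => h' i (hi.trans (Nat.lt_succ_self n))
    have h1 := hp.realizes_comp hg (h n (Nat.lt_succ_self n))
    rw [Set.image_union, hg.image_eq, image_initial, initial_congr hga] at h1
    obtain ⟨k, hk, hka⟩ := exists_fixes_of_realizes hM
      (small_union hM.aleph0_lt hA (initial_small hM a' n)) h1 (h' n (Nat.lt_succ_self n))
    refine ⟨k.comp g, (hk.mono Set.subset_union_left).comp hg, fun i hi => ?_⟩
    rcases Nat.lt_succ_iff_lt_or_eq.1 hi with hi | rfl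
    · funext s
      have h2 : g (a i s) = a' i s := congrFun (hga i hi) s
      rw [Function.comp_apply, Language.Equiv.comp_apply, h2]
      exact hk _ (Or.inr (mem_initial.2 ⟨i, hi, s, rfl⟩))
    · exact hka

/-- An automorphism over `A` may be corrected, outside of `S`, to fix a realization of an
`A`-invariant type over `S` and its image. -/
theorem InvariantOver.exists_fixes_eqOn {κ : Cardinal.{w}} (hM : IsMonster L M κ) {n : ℕ}
    {q : GlobalType L M (Fin n)} {A S : Set M} (hA : #A < κ) (hS : #S < κ)
    (hq : InvariantOver q A) {g : M ≃[L] M} (hg : Fixes g A) {b : Fin n → M}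
    (hb : Realizes b (restr q (A ∪ S))) (hb' : Realizes b (restr q (A ∪ g '' S))) :
    ∃ h : M ≃[L] M, Fixes h A ∧ h ∘ b = b ∧ ∀ x ∈ S, h x = g x := by
  have h1 := hq.realizes_comp hg hb
  rw [Set.image_union, hg.image_eq] at h1
  obtain ⟨k, hk, hkb⟩ := exists_fixes_of_realizes hM
    (small_union hM.aleph0_lt hA (mk_image_le.trans_lt hS)) h1 hb'
  refine ⟨k.comp g, (hk.mono Set.subset_union_left).comp hg, hkb, fun x hx => ?_⟩
  rw [Language.Equiv.comp_apply]
  exact hk _ (Or.inr ⟨x, hx, rfl⟩)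

/-! ### Generic stability: absence of splitting, and symmetry -/

/-- No definable set splits a Morley sequence of length `ω + ω` in a generically stable type. -/
theorem GenericallyStable.exists_forall_not_split {κ : Cardinal.{w}} {m : ℕ}
    {p : GlobalType L M (Fin m)} (h : GenericallyStable κ p) :
    ∃ A₀ : Set M, #A₀ < κ ∧ ∀ c c' : ℕ → Fin m → M, IsMorley p A₀ c →
      IsMorley p (A₀ ∪ ⋃ i, Set.range (c i)) c' →
      ∀ (B : Set M) (X : Set (Fin m → M)), B.Definable L X →
        ¬ ((∀ i, c i ∈ X) ∧ ∀ i, c' i ∉ X) := by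
  obtain ⟨-, A₀, hA₀, -, hA⟩ := h
  refine ⟨A₀, hA₀, fun c c' hc hc' B X hX hsplit => ?_⟩
  -- The order `ω + ω` is lifted to `Type w`, the universe of the index types in
  -- `GenericallyStable`.
  have hwf : WellFoundedLT (ULift.{w} (Lex (ℕ ⊕ ℕ))) :=
    ⟨InvImage.wf ULift.down (Sum.lex_wf (wellFounded_lt (α := ℕ)) (wellFounded_lt (α := ℕ)))⟩
  obtain ⟨φ, hφ⟩ := hX.mono (Set.subset_univ B)
  have hφ' : ∀ x, φ.Realize x ↔ x ∈ X := fun x => by rw [hφ]; rfl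
  let a : ULift.{w} (Lex (ℕ ⊕ ℕ)) → Fin m → M := fun i => Sum.elim c c' (ofLex i.down)
  have ha : IsMorley p A₀ a := by
    rintro ⟨i⟩
    rcases i with i | i
    · refine realizes_mono (Set.union_subset_union_right _ ?_) (hc i)
      refine Set.iUnion_subset ?_
      rintro ⟨⟨j⟩, hj⟩
      rcases j with j | j
      · exact Set.subset_iUnion_of_subset ⟨j, Sum.Lex.inl_lt_inl_iff.1 hj⟩ (fun x hx => hx)
      · exact absurd hj Sum.Lex.not_inr_lt_inl
    · refine realizes_mono (Set.union_subset ?_ ?_) (hc' i)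
      · exact Set.subset_union_left.trans Set.subset_union_left
      refine Set.iUnion_subset ?_
      rintro ⟨⟨j⟩, hj⟩
      rcases j with j | j
      · exact (Set.subset_iUnion (fun i => Set.range (c i)) j).trans
          (Set.subset_union_right.trans Set.subset_union_left)
      · exact (Set.subset_iUnion (fun j : {j : ℕ // j < i} => Set.range (c' j))
          ⟨j, Sum.Lex.inr_lt_inr_iff.1 hj⟩).trans Set.subset_union_right
  rcases hA _ a ha φ with hf | hf
  · refine Set.infinite_of_injective_forall_mem
      (f := fun i : ℕ => (ULift.up (toLex (Sum.inl i)) : ULift.{w} (Lex (ℕ ⊕ ℕ))))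
      (fun i j hij => Sum.inl_injective (congrArg (fun x => ofLex x.down) hij)) (fun i => ?_) hf
    exact (hφ' _).2 (hsplit.1 i)
  · refine Set.infinite_of_injective_forall_mem
      (f := fun i : ℕ => (ULift.up (toLex (Sum.inr i)) : ULift.{w} (Lex (ℕ ⊕ ℕ))))
      (fun i j hij => Sum.inr_injective (congrArg (fun x => ofLex x.down) hij)) (fun i => ?_) hf
    exact fun hr => hsplit.2 i ((hφ' _).1 hr)

theorem IsMorley.mem_of_definable {m : ℕ} {p : GlobalType L M (Fin m)} {A : Set M}
    {a : ℕ → Fin m → M} (h : IsMorley p A a) {X : Set (Fin m → M)} (hX : A.Definable L X)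
    (hp : Contains p X) (i : ℕ) : a i ∈ X :=
  realizes_restr_iff.1 (h i) X (hX.mono Set.subset_union_left) hp

/-- Generically stable types commute with themselves. -/
theorem GenericallyStable.realizes_symm {κ : Cardinal.{w}} (hM : IsMonster L M κ) {m : ℕ}
    {p : GlobalType L M (Fin m)} (h : GenericallyStable κ p) {B : Set M} (hB : #B < κ)
    (hp : InvariantOver p B) {a e : Fin m → M} (ha : Realizes a (restr p B))
    (he : Realizes e (restr p (B ∪ Set.range a))) : Realizes a (restr p (B ∪ Set.range e)) := by
  obtain ⟨A₀, hA₀, hsplit⟩ := h.exists_forall_not_split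
  by_contra hc
  rw [realizes_restr_iff] at hc
  push Not at hc
  obtain ⟨X, hX, hpX, haX⟩ := hc
  have hD : #(B ∪ A₀ : Set M) < κ := small_union hM.aleph0_lt hB hA₀
  obtain ⟨c, hcM⟩ := exists_morley hM p hD
  have hD' : #(B ∪ A₀ ∪ ⋃ i, Set.range (c i) : Set M) < κ :=
    small_union hM.aleph0_lt hD (iUnion_range_small hM c)
  -- `e'` is placed between `c` and `c'`. Every pair `(c i, e')` is conjugate to `(a, e)`, so each
  -- `c i` avoids the copy of `X` over `B` and `e'`, whereas each `c' i` is generic over `e'` and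
  -- lies in it.
  obtain ⟨e', he'⟩ := hM.saturated _ hD' m (restr p _)
  obtain ⟨c', hcM'⟩ := exists_morley hM p (small_union hM.aleph0_lt hD' (range_small hM e'))
  have hconj : ∀ i, ∃ g : M ≃[L] M, Fixes g B ∧ g ∘ a = c i ∧ g ∘ e = e' := by
    intro i
    obtain ⟨g, hg, hga⟩ := exists_fixes_of_realizes hM hB ha
      (realizes_mono (Set.subset_union_left.trans Set.subset_union_left) (hcM i))
    have h1 := hp.realizes_comp hg he
    rw [Set.image_union, hg.image_eq, ← Set.range_comp, hga] at h1
    obtain ⟨k, hk, hke⟩ := exists_fixes_of_realizes hM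
      (small_union hM.aleph0_lt hB (range_small hM (c i))) h1
      (realizes_mono (Set.union_subset_union Set.subset_union_left
        (Set.subset_iUnion (fun i => Set.range (c i)) i)) he')
    refine ⟨k.comp g, (hk.mono Set.subset_union_left).comp hg, funext fun s => ?_, hke⟩
    have h2 : g (a s) = c i s := congrFun hga s
    rw [Function.comp_apply, Language.Equiv.comp_apply, h2]
    exact hk _ (Or.inr ⟨s, rfl⟩)
  -- The index is immaterial: these automorphisms agree on `B` and on `e`, hence all move `X` to the
  -- same set.
  obtain ⟨g, hg, -, hge⟩ := hconj 0
  have hX' := definable_move g hX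
  rw [Set.image_union, hg.image_eq, ← Set.range_comp, hge] at hX'
  refine hsplit c c' (isMorley_mono Set.subset_union_right hcM)
    (isMorley_mono ((Set.union_subset_union_left _ Set.subset_union_right).trans
      Set.subset_union_left) hcM') _ _ hX'.compl ⟨fun i hi => ?_, fun i => not_not.2 ?_⟩
  · obtain ⟨k, hk, hka, hke⟩ := hconj i
    have hfix : Fixes (g.symm.comp k) (B ∪ Set.range e) := by
      rintro x (hx | ⟨s, rfl⟩)
      · exact (hg.symm.comp hk) x hx
      · rw [Language.Equiv.comp_apply, show k (e s) = g (e s) from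
          (congrFun hke s).trans (congrFun hge s).symm]
        exact g.symm_apply_apply _
    rw [← hka] at hi
    exact haX ((hfix.comp_mem_iff hX a).1 hi)
  · exact (isMorley_mono (Set.union_subset_union_left _
      (Set.subset_union_left.trans Set.subset_union_left)) hcM').mem_of_definable hX'
      ((hp.contains_move hg hX).2 hpX) i

/-- Symmetry is applied to one term at a time, with the preceding terms of `c` absorbed into the
base. -/
theorem GenericallyStable.realizes_union_initial {κ : Cardinal.{w}} (hM : IsMonster L M κ) {m : ℕ}
    {p : GlobalType L M (Fin m)} (h : GenericallyStable κ p) {B : Set M} (hB : #B < κ)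
    (hp : InvariantOver p B) {a : Fin m → M} (ha : Realizes a (restr p B)) {c : ℕ → Fin m → M}
    {n : ℕ} (hc : MorleyUpTo p (B ∪ Set.range a) c n) :
    Realizes a (restr p (B ∪ initial c n)) := by
  induction n with
  | zero => rwa [initial_zero, Set.union_empty]
  | succ n ih =>
    have h1 := hc n (Nat.lt_succ_self n)
    rw [Set.union_right_comm] at h1
    rw [initial_succ, ← Set.union_assoc]
    exact h.realizes_symm hM (small_union hM.aleph0_lt hB (initial_small hM c n))
      (invariantOver_mono Set.subset_union_left hp)
      (ih fun i hi => hc i (hi.trans (Nat.lt_succ_self n))) h1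

/-- This allows results over `A` to be reused after adjoining terms of Morley sequences to the base.
-/
theorem RegularOver.mono {κ : Cardinal.{w}} {m : ℕ} {p : GlobalType L M (Fin m)} {A C : Set M}
    (h : RegularOver κ p A) (hAC : A ⊆ C) : RegularOver κ p C :=
  ⟨h.1, invariantOver_mono hAC h.2.1, fun B hB hBκ a ha =>
    h.2.2 B (hAC.trans hB) hBκ a (realizes_mono hAC ha)⟩

end Morley

/-! ### From orthogonality to uniqueness of the type of a pair -/

section Orthogonality

variable {L : FirstOrder.Language.{u, v}} {M : Type w} [L.Structure M]

theorem elim_mem_iff_of_fixes {α β : Type} {A : Set M} {g : M ≃[L] M} (hg : Fixes g A)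
    {Z : Set (α ⊕ β → M)} (hZ : A.Definable L Z) (a : α → M) (b : β → M) :
    Sum.elim (g ∘ a) (g ∘ b) ∈ Z ↔ Sum.elim a b ∈ Z := by
  rw [← Sum.comp_elim]
  exact hg.comp_mem_iff hZ _

/-- If a relation over `A` holds between some realizations of `p ↾ A` and `q ↾ A`, then the
realization of `p` may be chosen independent from a given Morley sequence over which `b`
realizes `q`. -/
theorem exists_realizes_union_initial {κ : Cardinal.{w}} (hM : IsMonster L M κ) {m n : ℕ}
    {p : GlobalType L M (Fin m)} {q : GlobalType L M (Fin n)} {A : Set M} (hA : #A < κ)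
    (hgs : GenericallyStable κ p) (hreg : RegularOver κ p A) (hq : InvariantOver q A)
    {Z : Set (Fin m ⊕ Fin n → M)} (hZ : A.Definable L Z) {a₀ : Fin m → M} {b₀ : Fin n → M}
    (ha₀ : Realizes a₀ (restr p A)) (hb₀ : Realizes b₀ (restr q A)) (h₀ : Sum.elim a₀ b₀ ∈ Z)
    {a : ℕ → Fin m → M} {N : ℕ} (ha : MorleyUpTo p A a N) {b : Fin n → M}
    (hb : Realizes b (restr q (A ∪ initial a N))) :
    ∃ x, Realizes x (restr p (A ∪ initial a N)) ∧ Sum.elim x b ∈ Z := by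
  have hAS : #(A ∪ initial a N : Set M) < κ :=
    small_union hM.aleph0_lt hA (initial_small hM a N)
  obtain ⟨c, hc, hbc⟩ : ∃ c : ℕ → Fin m → M, MorleyUpTo p (A ∪ initial a N) c N ∧
      Realizes b (restr q (A ∪ initial a N ∪ initial c N)) := by
    -- Since `b` is prescribed, `c` is first chosen with an auxiliary `b'` generic over it, and then
    -- the pair is moved over `A` and `a` so that `b'` becomes `b`.
    obtain ⟨c, hc⟩ := exists_morley hM p hAS
    obtain ⟨b', hb'⟩ := hM.saturated _
      (small_union hM.aleph0_lt hAS (initial_small hM c N)) n (restr q _)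
    obtain ⟨k, hk, hkb⟩ := exists_fixes_of_realizes hM hAS
      (realizes_mono Set.subset_union_left hb') hb
    have hkA : Fixes k A := hk.mono Set.subset_union_left
    have h1 := (hc.upTo N).comp hreg.2.1 hkA
    have h2 := hq.realizes_comp hkA hb'
    rw [hk.image_eq] at h1
    rw [Set.image_union, hk.image_eq, image_initial, hkb] at h2
    exact ⟨_, h1, h2⟩
  obtain ⟨h, hh, hhb⟩ := exists_fixes_of_realizes hM hA hb₀
    (realizes_mono Set.subset_union_left hb)
  have hx : Realizes (h ∘ a₀) (restr p A) := by
    have := hreg.2.1.realizes_comp hh ha₀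
    rwa [hh.image_eq] at this
  have hxb : Sum.elim (h ∘ a₀) b ∈ Z := by
    rw [← hhb]
    exact (elim_mem_iff_of_fixes hh hZ a₀ b₀).2 h₀
  by_cases hdep : Realizes (h ∘ a₀) (restr p (A ∪ initial a N))
  · exact ⟨_, hdep, hxb⟩
  -- Not generic over `A` and `a`, the tuple `h ∘ a₀` is not generic over any larger base either.
  -- Regularity over each `A ∪ initial a N ∪ initial c i` therefore keeps `c i` generic once `h ∘
  -- a₀` is adjoined.
  have hc' : MorleyUpTo p (A ∪ Set.range (h ∘ a₀)) c N := by
    intro i hi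
    have h1 := (hreg.2.2 (A ∪ initial a N ∪ initial c i)
      (Set.subset_union_left.trans Set.subset_union_left)
      (small_union hM.aleph0_lt hAS (initial_small hM c i)) _ hx).resolve_left
        (fun h2 => hdep (realizes_mono Set.subset_union_left h2)) _ (hc i hi)
    refine realizes_mono (Set.union_subset (Set.union_subset_union_left _
      (Set.subset_union_left.trans Set.subset_union_left)) ?_) h1
    exact Set.subset_union_right.trans Set.subset_union_left
  have hxc := hgs.realizes_union_initial hM hA hreg.2.1 hx hc'
  obtain ⟨g, hg, hgc⟩ := (hc.mono Set.subset_union_left).exists_fixes hM hA hreg.2.1 ha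
  have hgi : g '' initial c N = initial a N := by rw [image_initial, initial_congr hgc]
  -- As `b` is generic in `q` over both `c` and `a`, the automorphism taking `c` to `a` can be made
  -- to fix `b`, which preserves the relation `Z` with `b`.
  obtain ⟨k, hk, hkb, hkg⟩ := hq.exists_fixes_eqOn hM hA (initial_small hM c N) hg
    (realizes_mono (Set.union_subset_union_left _ Set.subset_union_left) hbc)
    (by rwa [hgi])
  have hki : k '' initial c N = initial a N := by rw [← hgi, Set.image_congr hkg]
  have h3 := hreg.2.1.realizes_comp hk hxc
  rw [Set.image_union, hk.image_eq, hki] at h3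
  refine ⟨_, h3, ?_⟩
  rw [← hkb]
  exact (elim_mem_iff_of_fixes hk hZ _ b).2 hxb

/-- If a relation holding between some realizations of `p ↾ A` and `q ↾ A` is disjoint from a
rectangle `X × Y` with `X` in `p` and `Y` in `q`, then conjugates of `X` cut Morley sequences of
`p` at any place. -/
theorem exists_morley_cut {κ : Cardinal.{w}} (hM : IsMonster L M κ) {m n : ℕ}
    {p : GlobalType L M (Fin m)} {q : GlobalType L M (Fin n)} {A : Set M} (hA : #A < κ)
    (hgs : GenericallyStable κ p) (hreg : RegularOver κ p A) (hq : InvariantOver q A)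
    {Z : Set (Fin m ⊕ Fin n → M)} (hZ : A.Definable L Z) {a₀ : Fin m → M} {b₀ : Fin n → M}
    (ha₀ : Realizes a₀ (restr p A)) (hb₀ : Realizes b₀ (restr q A)) (h₀ : Sum.elim a₀ b₀ ∈ Z)
    {E : Set M} (hE : #E < κ) {X : Set (Fin m → M)} {Y : Set (Fin n → M)}
    (hX : E.Definable L X) (hY : E.Definable L Y) (hpX : Contains p X) (hqY : Contains q Y)
    (hXY : ∀ x ∈ X, ∀ y ∈ Y, Sum.elim x y ∉ Z) (N : ℕ) :
    ∃ (a : ℕ → Fin m → M) (g : ℕ → M ≃[L] M), MorleyUpTo p A a N ∧ ∀ i < N, Fixes (g i) A ∧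
      (∀ j ≤ i, a j ∈ move (g i) X) ∧ ∀ j < i, a i ∉ move (g j) X := by
  induction N with
  | zero =>
    exact ⟨fun _ => a₀, fun _ => Language.Equiv.refl L M, fun i hi => absurd hi (Nat.not_lt_zero i),
      fun i hi => absurd hi (Nat.not_lt_zero i)⟩
  | succ N ih =>
    obtain ⟨a, g, ha, hag⟩ := ih
    -- `G` contains the parameters of all earlier conjugates of `X` and `Y`, so a `b` generic over
    -- `G` lies in every `move (g j) Y`.
    let G : Set M := ⋃ j : {j : ℕ // j < N}, g j '' E
    have hG : #G < κ := by
      have : ∀ K : ℕ, #(⋃ j : {j : ℕ // j < K}, g j '' E : Set M) < κ := by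
        intro K
        induction K with
        | zero =>
          have : IsEmpty {j : ℕ // j < 0} := ⟨fun j => Nat.not_lt_zero _ j.2⟩
          rw [Set.iUnion_of_empty]
          simpa using aleph0_pos.trans hM.aleph0_lt
        | succ K ihK =>
          refine (mk_le_mk_of_subset ?_).trans_lt (small_union hM.aleph0_lt ihK
            ((mk_image_le (f := g K) (s := E)).trans_lt hE))
          refine Set.iUnion_subset ?_
          rintro ⟨j, hj⟩
          rcases Nat.lt_succ_iff_lt_or_eq.1 hj with hj | rfl
          · exact (Set.subset_iUnion (fun j : {j : ℕ // j < K} => g j '' E) ⟨j, hj⟩).trans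
              Set.subset_union_left
          · exact Set.subset_union_right
      exact this N
    obtain ⟨b, hb⟩ := hM.saturated _ (small_union hM.aleph0_lt
      (small_union hM.aleph0_lt hA (initial_small hM a N)) hG) n (restr q _)
    obtain ⟨x, hx, hxZ⟩ := exists_realizes_union_initial hM hA hgs hreg hq hZ ha₀ hb₀ h₀ ha
      (realizes_mono Set.subset_union_left hb)
    have hxg : ∀ j < N, x ∉ move (g j) X := by
      intro j hj hxj
      have hgj := (hag j hj).1
      have hbj : b ∈ move (g j) Y := realizes_restr_iff.1 hb _
        ((definable_move (g j) hY).mono ((Set.subset_iUnion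
          (fun j : {j : ℕ // j < N} => g j '' E) ⟨j, hj⟩).trans Set.subset_union_right))
        ((hq.contains_move hgj hY).2 hqY)
      exact hXY _ hxj _ hbj ((elim_mem_iff_of_fixes hgj.symm hZ x b).2 hxZ)
    let a' : ℕ → Fin m → M := Function.update a N x
    have haa' : ∀ i < N, a i = a' i := fun i hi => (Function.update_of_ne hi.ne x a).symm
    have ha'N : a' N = x := Function.update_self N x a
    have ha' : MorleyUpTo p A a' (N + 1) := by
      intro i hi
      rcases Nat.lt_succ_iff_lt_or_eq.1 hi with hi | rfl
      · exact ha.congr haa' i hi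
      · rw [ha'N, ← initial_congr haa']
        exact hx
    -- A Morley sequence over the parameters of `X` lies entirely in `X`. Moving it onto the
    -- extended sequence supplies the new automorphism.
    obtain ⟨c, hc⟩ := exists_morley hM p (small_union hM.aleph0_lt hA hE)
    obtain ⟨k, hk, hkc⟩ := ((isMorley_mono Set.subset_union_left hc).upTo
      (N + 1)).exists_fixes hM hA hreg.2.1 ha'
    refine ⟨a', Function.update g N k, ha', fun i hi => ?_⟩
    rcases Nat.lt_succ_iff_lt_or_eq.1 hi with hi | rfl
    · rw [Function.update_of_ne hi.ne]
      refine ⟨(hag i hi).1, fun j hj => ?_, fun j hj => ?_⟩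
      · rw [← haa' j (hj.trans_lt hi)]
        exact (hag i hi).2.1 j hj
      · rw [← haa' i hi, Function.update_of_ne (hj.trans hi).ne]
        exact (hag i hi).2.2 j hj
    · rw [Function.update_self]
      refine ⟨hk, fun j hj => ?_, fun j hj => ?_⟩
      · rw [← hkc j (Nat.lt_succ_of_le hj), comp_mem_move]
        exact (isMorley_mono Set.subset_union_right hc).mem_of_definable hX hpX j
      · rw [ha'N, Function.update_of_ne hj.ne]
        exact hxg j hj

/-- Otherwise cuts of arbitrary finite length would exist. All conjugates of `X` are instances of
one formula `θ`, so saturation turns these cuts into one parameter tuple `e'` for which `θ` splits a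
sequence of length `ω + ω`. -/
theorem elim_notMem_of_rectangle [Nonempty M] {κ : Cardinal.{w}} (hM : IsMonster L M κ) {m n : ℕ}
    {p : GlobalType L M (Fin m)} {q : GlobalType L M (Fin n)} {A : Set M} (hA : #A < κ)
    (hgs : GenericallyStable κ p) (hreg : RegularOver κ p A) (hq : InvariantOver q A)
    {Z : Set (Fin m ⊕ Fin n → M)} (hZ : A.Definable L Z) {a₀ : Fin m → M} {b₀ : Fin n → M}
    (ha₀ : Realizes a₀ (restr p A)) (hb₀ : Realizes b₀ (restr q A))
    {X : Set (Fin m → M)} {Y : Set (Fin n → M)}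
    (hX : (Set.univ : Set M).Definable L X) (hY : (Set.univ : Set M).Definable L Y)
    (hpX : Contains p X) (hqY : Contains q Y)
    (hXY : ∀ x ∈ X, ∀ y ∈ Y, Sum.elim x y ∉ Z) : Sum.elim a₀ b₀ ∉ Z := by
  intro h₀
  obtain ⟨F, -, hXF⟩ := Set.definable_iff_finitely_definable.1 hX
  obtain ⟨F', -, hYF⟩ := Set.definable_iff_finitely_definable.1 hY
  have hE : #((F : Set M) ∪ F' : Set M) < κ := small_union hM.aleph0_lt
    (small_finset hM.aleph0_lt F) (small_finset hM.aleph0_lt F')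
  have hcut := exists_morley_cut hM hA hgs hreg hq hZ ha₀ hb₀ h₀ hE
    (hXF.mono Set.subset_union_left) (hYF.mono Set.subset_union_right) hpX hqY hXY
  obtain ⟨k, θ, e, -, hθ⟩ := definable_iff_exists_tuple.1 hX
  obtain ⟨A₀, hA₀, hsplit⟩ := hgs.exists_forall_not_split
  have hD : #(A ∪ A₀ : Set M) < κ := small_union hM.aleph0_lt hA hA₀
  obtain ⟨c, hc⟩ := exists_morley hM p hD
  obtain ⟨c', hc'⟩ := exists_morley hM p
    (small_union hM.aleph0_lt hD (iUnion_range_small hM c))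
  let B : Set M := (⋃ i, Set.range (c i)) ∪ ⋃ i, Set.range (c' i)
  have hBκ : #B < κ := small_union hM.aleph0_lt (iUnion_range_small hM c)
    (iUnion_range_small hM c')
  have hdef : ∀ d : Fin m → M, (∀ s, d s ∈ B) →
      B.Definable L {y : Fin k → M | θ.Realize (Sum.elim d y)} := by
    intro d hd
    refine definable_iff_exists_tuple.2 ⟨m, θ.relabel Sum.swap, d, hd, fun y => ?_⟩
    rw [Formula.realize_relabel]
    have : Sum.elim y d ∘ Sum.swap = Sum.elim d y := by
      funext s
      rcases s with s | s <;> rfl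
    rw [this]
    rfl
  obtain ⟨e', he'⟩ := exists_mem_of_finite_inter hM hBκ
    (fun i => {y : Fin k → M | θ.Realize (Sum.elim (c i) y)} ∩
      {y : Fin k → M | θ.Realize (Sum.elim (c' i) y)}ᶜ)
    (fun i => (hdef _ fun s => Or.inl (Set.mem_iUnion.2 ⟨i, s, rfl⟩)).inter
      (hdef _ fun s => Or.inr (Set.mem_iUnion.2 ⟨i, s, rfl⟩)).compl) fun N => by
    -- The cut used is the one at index `N`: it has `N + 1` terms on each side. Two blocks of length
    -- `N` would leave no index to cut at when `N = 0`.
    obtain ⟨a, g, ha, hag⟩ := hcut (N + 1 + (N + 1))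
    let d : ℕ → Fin m → M := fun i => if i < N + 1 then c i else c' (i - (N + 1))
    have hd₁ : ∀ i < N + 1, d i = c i := fun i hi => if_pos hi
    have hd₂ : ∀ i, d (N + 1 + i) = c' i := fun i => by
      simp only [d, if_neg (Nat.not_lt.2 (Nat.le_add_right (N + 1) i)), Nat.add_sub_cancel_left]
    -- Omitting the rest of `c` does no harm, because `c'` is Morley over all of `c`.
    have hd : MorleyUpTo p A d (N + 1 + (N + 1)) := by
      intro i _
      rcases Nat.lt_or_ge i (N + 1) with hi | hi
      · rw [hd₁ i hi, initial_congr fun j hj => hd₁ j (hj.trans hi)]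
        exact isMorley_mono Set.subset_union_left hc i
      · obtain ⟨i, rfl⟩ := Nat.exists_eq_add_of_le hi
        rw [hd₂]
        refine realizes_mono ?_ (hc' i)
        rintro x (hx | hx)
        · exact Or.inl (Or.inl (Or.inl hx))
        · obtain ⟨j, hj, s, rfl⟩ := mem_initial.1 hx
          rcases Nat.lt_or_ge j (N + 1) with hjN | hjN
          · rw [hd₁ j hjN]
            exact Or.inl (Or.inr (Set.mem_iUnion.2 ⟨j, s, rfl⟩))
          · obtain ⟨j, rfl⟩ := Nat.exists_eq_add_of_le hjN
            rw [hd₂]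
            exact Or.inr (mem_initial.2 ⟨j, Nat.lt_of_add_lt_add_left hj, s, rfl⟩)
    obtain ⟨h, -, hh⟩ := ha.exists_fixes hM hA hreg.2.1 hd
    have key : ∀ i < N + 1 + (N + 1),
        (θ.Realize (Sum.elim (d i) (h ∘ g N ∘ e)) ↔ a i ∈ move (g N) X) := by
      intro i hi
      rw [mem_move_iff (g N) hθ, ← hh i hi, ← Sum.comp_elim, realize_comp_equiv]
    refine ⟨h ∘ g N ∘ e, fun i hi => ⟨?_, fun hcon => ?_⟩⟩
    · have h1 := (key i (by omega)).2 ((hag N (by omega)).2.1 i hi.le)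
      rwa [hd₁ i (by omega)] at h1
    · refine (hag (N + 1 + i) (by omega)).2.2 N (by omega) ((key _ (by omega)).1 ?_)
      rw [hd₂]
      exact hcon
  exact hsplit c c' (isMorley_mono Set.subset_union_right hc)
    (isMorley_mono (Set.union_subset_union_left _ Set.subset_union_right) hc') Set.univ
    {x | θ.Realize (Sum.elim x e')}
    (definable_iff_exists_tuple.2 ⟨k, θ, e', fun _ => Set.mem_univ _, fun _ => Iff.rfl⟩)
    ⟨fun i => (he' i).1, fun i => (he' i).2⟩

/-- For orthogonal `p` and `q`, with `p` generically stable and regular over `A`, all pairs of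
realizations of `p ↾ A` and `q ↾ A` have the same type over `A`. -/
theorem sameType_elim_of_orthogonal [Nonempty M] {κ : Cardinal.{w}} (hM : IsMonster L M κ)
    {m n : ℕ} {p : GlobalType L M (Fin m)} {q : GlobalType L M (Fin n)} {A : Set M} (hA : #A < κ)
    (hgs : GenericallyStable κ p) (hreg : RegularOver κ p A) (hq : InvariantOver q A)
    (hpq : Orthogonal p q) {a a' : Fin m → M} {b b' : Fin n → M}
    (ha : Realizes a (restr p A)) (ha' : Realizes a' (restr p A))
    (hb : Realizes b (restr q A)) (hb' : Realizes b' (restr q A)) :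
    SameType L A (Sum.elim a b) (Sum.elim a' b') := by
  intro φ
  have hZ : A.Definable L {z : Fin m ⊕ Fin n → M | φ.Realize z} := ⟨φ, rfl⟩
  obtain ⟨X, Y, hX, hY, hpX, hqY, h | h⟩ := hpq.exists_contains hZ
  -- A rectangle inside the relation is disjoint from its complement, to which the previous lemma
  -- applies.
  · have key : ∀ (a : Fin m → M) (b : Fin n → M), Realizes a (restr p A) →
        Realizes b (restr q A) → φ.Realize (Sum.elim a b) := fun a b ha hb =>
      not_not.1 (elim_notMem_of_rectangle hM hA hgs hreg hq hZ.compl ha hb hX hY hpX hqY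
        fun x hx y hy hc => hc (h x hx y hy))
    exact iff_of_true (key a b ha hb) (key a' b' ha' hb')
  · have key : ∀ (a : Fin m → M) (b : Fin n → M), Realizes a (restr p A) →
        Realizes b (restr q A) → ¬ φ.Realize (Sum.elim a b) := fun a b ha hb =>
      elim_notMem_of_rectangle hM hA hgs hreg hq hZ ha hb hX hY hpX hqY h
    exact iff_of_false (key a b ha hb) (key a' b' ha' hb')

/-! ### Independence of realizations and of Morley sequences in orthogonal types -/

theorem realizes_union_range_of_orthogonal [Nonempty M] {κ : Cardinal.{w}} (hM : IsMonster L M κ)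
    {m n : ℕ} {p : GlobalType L M (Fin m)} {q : GlobalType L M (Fin n)} {A : Set M} (hA : #A < κ)
    (hgs : GenericallyStable κ p) (hreg : RegularOver κ p A) (hq : InvariantOver q A)
    (hpq : Orthogonal p q) {a : Fin m → M} {b : Fin n → M} (ha : Realizes a (restr p A))
    (hb : Realizes b (restr q A)) :
    Realizes a (restr p (A ∪ Set.range b)) ∧ Realizes b (restr q (A ∪ Set.range a)) := by
  constructor
  · obtain ⟨a', ha'⟩ := hM.saturated _
      (small_union hM.aleph0_lt hA (range_small hM b)) m (restr p _)
    -- The pair `(a', b)` is generic by choice and `(a, b)` has the same type over `A`, so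
    -- genericity is transported along an automorphism fixing `b`.
    obtain ⟨g, hg, hgab⟩ := exists_fixes_comp_eq hM hA (sameType_elim_of_orthogonal hM hA hgs hreg
      hq hpq (realizes_mono Set.subset_union_left ha') ha hb hb)
    have h1 : g ∘ a' = a := congrArg (· ∘ Sum.inl) hgab
    have h2 : g ∘ b = b := congrArg (· ∘ Sum.inr) hgab
    have h3 := hreg.2.1.realizes_comp hg ha'
    rwa [Set.image_union, hg.image_eq, ← Set.range_comp, h1, h2] at h3
  · obtain ⟨b', hb'⟩ := hM.saturated _
      (small_union hM.aleph0_lt hA (range_small hM a)) n (restr q _)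
    obtain ⟨g, hg, hgab⟩ := exists_fixes_comp_eq hM hA (sameType_elim_of_orthogonal hM hA hgs hreg
      hq hpq ha ha (realizes_mono Set.subset_union_left hb') hb)
    have h1 : g ∘ a = a := congrArg (· ∘ Sum.inl) hgab
    have h2 : g ∘ b' = b := congrArg (· ∘ Sum.inr) hgab
    have h3 := hq.realizes_comp hg hb'
    rwa [Set.image_union, hg.image_eq, ← Set.range_comp, h1, h2] at h3

/-- Both halves of `realizes_union_range_of_orthogonal` are needed: `a i` remains generic over `b`,
and `b` remains generic after `a i` joins the base, which permits the next step. -/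
theorem morleyUpTo_union_range_of_orthogonal [Nonempty M] {κ : Cardinal.{w}}
    (hM : IsMonster L M κ) {m n : ℕ} {p : GlobalType L M (Fin m)} {q : GlobalType L M (Fin n)}
    {A : Set M} (hA : #A < κ) (hgs : GenericallyStable κ p) (hreg : RegularOver κ p A)
    (hq : InvariantOver q A) (hpq : Orthogonal p q) {a : ℕ → Fin m → M} {b : Fin n → M} {N : ℕ}
    (ha : MorleyUpTo p A a N) (hb : Realizes b (restr q A)) :
    MorleyUpTo p (A ∪ Set.range b) a N := by
  have step : ∀ i < N, Realizes b (restr q (A ∪ initial a i)) →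
      Realizes (a i) (restr p (A ∪ initial a i ∪ Set.range b)) ∧
      Realizes b (restr q (A ∪ initial a i ∪ Set.range (a i))) := fun i hi hbi =>
    realizes_union_range_of_orthogonal hM
      (small_union hM.aleph0_lt hA (initial_small hM a i)) hgs (hreg.mono Set.subset_union_left)
      (invariantOver_mono Set.subset_union_left hq) hpq (ha i hi) hbi
  have key : ∀ i ≤ N, Realizes b (restr q (A ∪ initial a i)) := by
    intro i
    induction i with
    | zero => intro _; rwa [initial_zero, Set.union_empty]
    | succ i ih =>
      intro hi
      rw [initial_succ, ← Set.union_assoc]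
      exact (step i hi (ih (Nat.le_of_succ_le hi))).2
  intro i hi
  rw [Set.union_right_comm]
  exact (step i hi (key i hi.le)).1

/-- The terms of `b` are adjoined one by one, each generic in `q` over the base enlarged by its
predecessors. -/
theorem morleyUpTo_union_initial_of_orthogonal [Nonempty M] {κ : Cardinal.{w}}
    (hM : IsMonster L M κ) {m n : ℕ} {p : GlobalType L M (Fin m)} {q : GlobalType L M (Fin n)}
    {A : Set M} (hA : #A < κ) (hgs : GenericallyStable κ p) (hreg : RegularOver κ p A)
    (hq : InvariantOver q A) (hpq : Orthogonal p q) {a : ℕ → Fin m → M} {b : ℕ → Fin n → M}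
    {N K : ℕ} (ha : MorleyUpTo p A a N) (hb : MorleyUpTo q A b K) :
    MorleyUpTo p (A ∪ initial b K) a N := by
  induction K with
  | zero => rwa [initial_zero, Set.union_empty]
  | succ K ih =>
    rw [initial_succ, ← Set.union_assoc]
    exact morleyUpTo_union_range_of_orthogonal hM
      (small_union hM.aleph0_lt hA (initial_small hM b K)) hgs (hreg.mono Set.subset_union_left)
      (invariantOver_mono Set.subset_union_left hq) hpq
      (ih fun i hi => hb i (hi.trans (Nat.lt_succ_self K))) (hb K (Nat.lt_succ_self K))

/-- Pairs of finite Morley sequences in orthogonal types are conjugate. -/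
theorem exists_fixes_of_orthogonal [Nonempty M] {κ : Cardinal.{w}}
    (hM : IsMonster L M κ) {m n : ℕ} {p : GlobalType L M (Fin m)} {q : GlobalType L M (Fin n)}
    {A : Set M} (hA : #A < κ) (hgs : GenericallyStable κ p) (hreg : RegularOver κ p A)
    (hq : InvariantOver q A) (hpq : Orthogonal p q) {a a' : ℕ → Fin m → M} {b b' : ℕ → Fin n → M}
    {N : ℕ} (ha : MorleyUpTo p A a N) (ha' : MorleyUpTo p A a' N) (hb : MorleyUpTo q A b N)
    (hb' : MorleyUpTo q A b' N) :
    ∃ g : M ≃[L] M, Fixes g A ∧ ∀ i < N, g ∘ a i = a' i ∧ g ∘ b i = b' i := by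
  obtain ⟨g, hg, hgb⟩ := hb.exists_fixes hM hA hq hb'
  have h1 := (morleyUpTo_union_initial_of_orthogonal hM hA hgs hreg hq hpq ha hb).comp
    hreg.2.1 hg
  rw [Set.image_union, hg.image_eq, image_initial, initial_congr hgb] at h1
  -- With `b` already moved to `b'`, the image of `a` and `a'` are both Morley over `A` and `b'`, so
  -- they can be matched without disturbing `b'`.
  obtain ⟨k, hk, hka⟩ := h1.exists_fixes hM
    (small_union hM.aleph0_lt hA (initial_small hM b' N))
    (invariantOver_mono Set.subset_union_left hreg.2.1)
    (morleyUpTo_union_initial_of_orthogonal hM hA hgs hreg hq hpq ha' hb')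
  refine ⟨k.comp g, (hk.mono Set.subset_union_left).comp hg, fun i hi => ⟨hka i hi, ?_⟩⟩
  funext s
  have h2 : g (b i s) = b' i s := congrFun (hgb i hi) s
  rw [Function.comp_apply, Language.Equiv.comp_apply, h2]
  exact hk _ (Or.inr (mem_initial.2 ⟨i, hi, s, rfl⟩))

/-! ### Weak orthogonality of the restrictions and of their powers -/

theorem mem_relabel_relabel {C : Set M} {γ δ ε : Type} (r : TypeOver L C γ) (f : δ → γ)
    (g : ε → δ) (ψ : L[[C]].Formula ε) :
    Mem ((ψ.relabel g).relabel f) r ↔ Mem (ψ.relabel (f ∘ g)) r := by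
  obtain ⟨N, x, hx⟩ := exists_realization r
  rw [hx, hx, Formula.realize_relabel, Formula.realize_relabel, Formula.realize_relabel]
  rfl

/-- Weak orthogonality, from the uniqueness of the type of pairs of realizations. -/
theorem weaklyOrthogonal_of_forall_realize [Nonempty M] {C : Set M} {α β : Type}
    {p : TypeOver L C α} {q : TypeOver L C β} {a : α → M} {b : β → M} (ha : Realizes a p)
    (hb : Realizes b q)
    (h : ∀ r : TypeOver L C (α ⊕ β), (∀ φ : L[[C]].Formula α, Mem φ p → Mem (φ.relabel Sum.inl) r) →
      (∀ φ : L[[C]].Formula β, Mem φ q → Mem (φ.relabel Sum.inr) r) →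
      ∀ φ : L[[C]].Formula (α ⊕ β), φ.Realize (Sum.elim a b) → Mem φ r) :
    WeaklyOrthogonal p q := by
  refine ⟨(L[[C]].completeTheory M).typeOf (Sum.elim a b), ⟨fun φ hφ => ?_, fun φ hφ => ?_⟩,
    fun r hr => ?_⟩
  · refine Theory.CompleteType.formula_mem_typeOf.2 ?_
    rw [Formula.realize_relabel, Sum.elim_comp_inl]
    exact ha φ hφ
  · refine Theory.CompleteType.formula_mem_typeOf.2 ?_
    rw [Formula.realize_relabel, Sum.elim_comp_inr]
    exact hb φ hφ
  · have key : ∀ φ : L[[C]].Formula (α ⊕ β), Mem φ r ↔ φ.Realize (Sum.elim a b) := by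
      intro φ
      refine ⟨fun h1 => ?_, h r hr.1 hr.2 φ⟩
      by_contra h2
      exact (mem_not r φ).1 (h r hr.1 hr.2 φ.not (Formula.realize_not.2 h2)) h1
    refine SetLike.ext fun σ => ?_
    have h1 := (key (Formula.equivSentence.symm σ)).trans
      (Theory.CompleteType.mem_typeOf (T := L[[C]].completeTheory M)).symm
    rwa [Mem, Equiv.apply_symm_apply] at h1

theorem weaklyOrthogonal_restr [Nonempty M] {κ : Cardinal.{w}} (hM : IsMonster L M κ)
    {m n : ℕ} {p : GlobalType L M (Fin m)} {q : GlobalType L M (Fin n)} {C : Set M} (hC : #C < κ)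
    (hgs : GenericallyStable κ p) (hreg : RegularOver κ p C) (hq : InvariantOver q C)
    (hpq : Orthogonal p q) : WeaklyOrthogonal (restr p C) (restr q C) := by
  obtain ⟨a, ha⟩ := hM.saturated C hC m (restr p C)
  obtain ⟨b, hb⟩ := hM.saturated C hC n (restr q C)
  refine weaklyOrthogonal_of_forall_realize ha hb fun r hrp hrq φ hφ => ?_
  obtain ⟨c, hc⟩ := exists_realize_iff_mem_relabel hM hC r id
  have hcp : Realizes (c ∘ Sum.inl) (restr p C) := fun ψ hψ => by
    rw [← Formula.realize_relabel, hc, mem_relabel_relabel]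
    exact hrp ψ hψ
  have hcq : Realizes (c ∘ Sum.inr) (restr q C) := fun ψ hψ => by
    rw [← Formula.realize_relabel, hc, mem_relabel_relabel]
    exact hrq ψ hψ
  have h1 := (sameType_elim_of_orthogonal hM hC hgs hreg hq hpq ha hcp hb hcq φ).1 hφ
  rw [Sum.elim_comp_inl_inr, hc] at h1
  obtain ⟨N, x, hx⟩ := exists_realization r
  rw [hx] at h1 ⊢
  rwa [Formula.realize_relabel, Function.comp_id] at h1

/-- Tuples which have the type of a finite Morley sequence form a Morley sequence. -/
theorem exists_morleyUpTo_of_realizes [Nonempty M] {κ : Cardinal.{w}} (hM : IsMonster L M κ)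
    {m : ℕ} {p : GlobalType L M (Fin m)} (hp : ∃ A : Set M, #A < κ ∧ InvariantOver p A)
    {C : Set M} (hC : #C < κ) (hpC : InvariantOver p C) {N : ℕ} {d : Fin N × Fin m → M}
    (hd : ∀ ψ : L[[C]].Formula (Fin N × Fin m), Mem (ψ.relabel (Prod.map Fin.val id))
      (restr (omegaPower hM p hp) C) → ψ.Realize d) :
    ∃ a : ℕ → Fin m → M, MorleyUpTo p C a N ∧ ∀ x : Fin N × Fin m, a x.1 x.2 = d x := by
  obtain ⟨c, hc⟩ := exists_morley hM p hC
  have hr := realizes_omegaPower hM p hp hC hpC hc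
  have key : ∀ ψ : L[[C]].Formula (Fin N × Fin m),
      ψ.Realize (fun x : Fin N × Fin m => c x.1 x.2) → ψ.Realize d := fun ψ hψ => by
    refine hd ψ ((realizes_iff hr _).1 ?_)
    rw [Formula.realize_relabel]
    exact hψ
  have hst : SameType L C (fun x : Fin N × Fin m => c x.1 x.2) d := fun ψ =>
    ⟨key ψ, fun h1 => by
      by_contra h2
      exact Formula.realize_not.1 (key ψ.not (Formula.realize_not.2 h2)) h1⟩
  obtain ⟨g, hg, hgd⟩ := exists_fixes_comp_eq hM hC hst
  have h1 := (hc.upTo N).comp hpC hg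
  rw [hg.image_eq] at h1
  exact ⟨_, h1, fun x => congrFun hgd x⟩

/-- Saturation concerns finitely many variables, so a completion `r` is realized only on a finite
part containing the variables of the given formula. The realization is a pair of finite Morley
sequences, conjugate over `C` to initial segments of `a` and `b`. -/
theorem weaklyOrthogonal_restr_omegaPower [Nonempty M] {κ : Cardinal.{w}} (hM : IsMonster L M κ)
    {m n : ℕ} {p : GlobalType L M (Fin m)} {q : GlobalType L M (Fin n)}
    (hp' : ∃ A : Set M, #A < κ ∧ InvariantOver p A)
    (hq' : ∃ A : Set M, #A < κ ∧ InvariantOver q A) {C : Set M} (hC : #C < κ)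
    (hgs : GenericallyStable κ p) (hreg : RegularOver κ p C) (hq : InvariantOver q C)
    (hpq : Orthogonal p q) :
    WeaklyOrthogonal (restr (omegaPower hM p hp') C) (restr (omegaPower hM q hq') C) := by
  classical
  obtain ⟨a, ha⟩ := exists_morley hM p hC
  obtain ⟨b, hb⟩ := exists_morley hM q hC
  refine weaklyOrthogonal_of_forall_realize (realizes_omegaPower hM p hp' hC hreg.2.1 ha)
    (realizes_omegaPower hM q hq' hC hq hb) fun r hrp hrq φ hφ => ?_
  -- `N` exceeds every sequence index occurring in `φ`, on either side.
  let N : ℕ := φ.freeVarFinset.sup fun x => Sum.elim Prod.fst Prod.fst x + 1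
  have hN : ∀ x : φ.freeVarFinset,
      (Sum.elim Prod.fst Prod.fst (x : (ℕ × Fin m) ⊕ (ℕ × Fin n)) : ℕ) < N := fun x =>
    Finset.le_sup (f := fun x : (ℕ × Fin m) ⊕ (ℕ × Fin n) =>
      (Sum.elim Prod.fst Prod.fst x : ℕ) + 1) x.2
  let f : (Fin N × Fin m) ⊕ (Fin N × Fin n) → (ℕ × Fin m) ⊕ (ℕ × Fin n) :=
    Sum.map (Prod.map Fin.val id) (Prod.map Fin.val id)
  have hf : ∀ x : φ.freeVarFinset, ∃ y, f y = x := by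
    rintro ⟨x | x, hx⟩
    · exact ⟨Sum.inl (⟨x.1, hN ⟨_, hx⟩⟩, x.2), rfl⟩
    · exact ⟨Sum.inr (⟨x.1, hN ⟨_, hx⟩⟩, x.2), rfl⟩
  choose t ht using hf
  let ψ : L[[C]].Formula ((Fin N × Fin m) ⊕ (Fin N × Fin n)) :=
    BoundedFormula.restrictFreeVar φ t
  obtain ⟨c, hc⟩ := exists_realize_iff_mem_relabel hM hC r f
  obtain ⟨a', ha', hca⟩ := exists_morleyUpTo_of_realizes hM hp' hC hreg.2.1
    (d := c ∘ Sum.inl) fun χ hχ => by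
      rw [← Formula.realize_relabel, hc, mem_relabel_relabel]
      exact (mem_relabel_relabel r Sum.inl _ χ).1 (hrp _ hχ)
  obtain ⟨b', hb', hcb⟩ := exists_morleyUpTo_of_realizes hM hq' hC hq
    (d := c ∘ Sum.inr) fun χ hχ => by
      rw [← Formula.realize_relabel, hc, mem_relabel_relabel]
      exact (mem_relabel_relabel r Sum.inr _ χ).1 (hrq _ hχ)
  obtain ⟨g, hg, hgab⟩ := exists_fixes_of_orthogonal hM hC hgs hreg hq hpq (ha.upTo N) ha'
    (hb.upTo N) hb'
  have hgc : g ∘ (Sum.elim (fun x : ℕ × Fin m => a x.1 x.2) fun x : ℕ × Fin n => b x.1 x.2) ∘ f =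
      c := by
    funext x
    rcases x with x | x
    · exact (congrFun (hgab x.1 x.1.2).1 x.2).trans (hca x)
    · exact (congrFun (hgab x.1 x.1.2).2 x.2).trans (hcb x)
  have h1 : ψ.Realize ((Sum.elim (fun x : ℕ × Fin m => a x.1 x.2)
      fun x : ℕ × Fin n => b x.1 x.2) ∘ f) :=
    (BoundedFormula.realize_restrictFreeVar _ fun x => by
      rw [Function.comp_apply, ht]).2 hφ
  rw [← hg.realize_iff, hgc, hc] at h1
  obtain ⟨K, x, hx⟩ := exists_realization r
  rw [hx, Formula.realize_relabel] at h1
  rw [hx]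
  exact (BoundedFormula.realize_restrictFreeVar _ fun y => by
    rw [Function.comp_apply, ht]).1 h1

end Orthogonality

end InvType

theorem mainTheorem5 {L : FirstOrder.Language.{u, v}} {M : Type w} [L.Structure M] [Nonempty M]
    {κ : Cardinal.{w}} (hM : InvType.IsMonster L M κ) {m n : ℕ}
    (p : InvType.GlobalType L M (Fin m)) (q : InvType.GlobalType L M (Fin n))
    (A : Set M) (hA : #A < κ)
    (hgs : InvType.GenericallyStable κ p) (hreg : InvType.RegularOver κ p A)
    (hq : InvType.InvariantOver q A) (hpq : InvType.Orthogonal p q) :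
    (∀ C : Set M, A ⊆ C → #C < κ →
      InvType.WeaklyOrthogonal (InvType.restr p C) (InvType.restr q C)) ∧
    (∀ C : Set M, A ⊆ C → #C < κ →
      InvType.WeaklyOrthogonal
        (InvType.restr (InvType.omegaPower hM p ⟨A, hA, hreg.2.1⟩) C)
        (InvType.restr (InvType.omegaPower hM q ⟨A, hA, hq⟩) C)) :=
  ⟨fun _ hAC hC => InvType.weaklyOrthogonal_restr hM hC hgs (hreg.mono hAC)
      (InvType.invariantOver_mono hAC hq) hpq,
    fun _ hAC hC => InvType.weaklyOrthogonal_restr_omegaPower hM _ _ hC hgs (hreg.mono hAC)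
      (InvType.invariantOver_mono hAC hq) hpq⟩
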